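/- Let $\omega,c\in\mathbb R$ with $c/\omega>0$. Let $u=u(x,t)$ be a real-valued classical solution of the Camassa–Holm equation $$u_t-u_{txx}+2\omega u_x+3uu_x=2u_xu_{xx}+uu_{xxx},\qquad x\in\mathbb R,\ t>0,$$ such that for every $t\ge 0$ one has $u(x,t)\to c$ as $x\to-\infty$ and $u(x,t)\to 0$ as $x\to+\infty$, and such that, with $m=u-u_{xx}$, $(m(x,t)+\omega)/\omega>0$ for all $x\in\mathbb R$, $t\ge0$, and, for some integer $l\ge 0$ and every $T\ge 0$, $$\sup_{0\le t\le T}\int_{-\infty}^{\infty}(1+|x|)^{l+1}\bigl(|m(x,t)-cH(-x)|+|m_x(x,t)|+|m_{xx}(x,t)|\bigr)\,dx<\infty ,$$ where $H(x)=1$ for $x\ge0$ and $H(x)=0$ for $x<0$. (Classical means that $u,u_x,u_{xx},u_{xxx},u_t,u_{tx},u_{txx}$ exist and are continuous for $t>0$; in addition $u(\cdot,t)\in C^4(\mathbb R)$ for each $t\ge 0$.) For $k\in\mathbb C$ put $\lambda=k^2+\tfrac14$ and $z(k)=\sqrt{k^2+\tfrac{c}{4(c+\omega)}}$, with the cut along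 the segment joining $\pm i\sqrt{\tfrac{c}{4(c+\omega)}}$ and the branch with $z(k)\sim k$ as $k\to\infty$; on the cut $z(k)$ stands for either of the two boundary values $z(k\pm0)$. Consider the equation $$\frac{\omega}{m+\omega}\Bigl(-\varphi_{xx}+\tfrac14\varphi\Bigr)=\lambda\varphi. \qquad (1)$$ For $\lambda\ne0$ and $\operatorname{Im}k\ge0$, let $\varphi_+(x,t;k)$ be the solution of (1) for each $t\ge0$ with $$\lim_{x\to+\infty}e^{-ikx+\frac{i\omega kt}{2\lambda}}\varphi_+(x,t;k)=1;$$ for $\lambda\ne0$ and $\operatorname{Im}z(k)\ge0$, let $\varphi_-(x,t;k)$ be the solution of (1) for each $t\ge0$ with $$\lim_{x\to-\infty}\sqrt[4]{\tfrac{c+\omega}{\omega}}\,\exp\Bigl\{iz\sqrt{\tfrac{c+\omega}{\omega}}\Bigl(x-\bigl(c+\tfrac{\omega}{2\lambda}\bigr)t\Bigr)\Bigr\}\varphi_-(x,t;k)=1 .$$ Then, for all these $k$, the Jost solutions $\varphi=\varphi_\pm(x,t;k)$ are differentiable in $t$ for $t>0$ and satisfy $$\varphi_t=-\Bigl(\frac{\omega}{2\lambda}+u\Bigr)\varphi_x+\frac{u_x}{2}\varphi,\qquad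 x\in\mathbb R,\ t>0 .$$ -/

import Mathlib

open Filter Topology Set MeasureTheory

noncomputable section

namespace CamassaHolm

/-- Partial derivative in the space variable of a function of `(x, t)`. -/
def dx (f : ℝ → ℝ → ℝ) : ℝ → ℝ → ℝ := fun x t => deriv (fun y => f y t) x

/-- Partial derivative in the time variable of a function of `(x, t)`. -/
def dt (f : ℝ → ℝ → ℝ) : ℝ → ℝ → ℝ := fun x t => deriv (fun s => f x s) t

/-- The momentum `m = u - u_xx`. -/
def momentum (u : ℝ → ℝ → ℝ) : ℝ → ℝ → ℝ := fun x t => u x t - dx (dx u) x t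

/-- The Heaviside function, `H x = 1` for `x ≥ 0` and `H x = 0` for `x < 0`. -/
def heaviside (x : ℝ) : ℝ := if 0 ≤ x then 1 else 0

/-- The function `f` of `(x, t)` is jointly continuous on `ℝ × (0, ∞)`. -/
def ContinuousPosTime (f : ℝ → ℝ → ℝ) : Prop :=
  ContinuousOn (fun p : ℝ × ℝ => f p.1 p.2) {p | 0 < p.2}

/-- `u` is a real-valued classical solution of the Camassa-Holm equation
`u_t - u_txx + 2 ω u_x + 3 u u_x = 2 u_x u_xx + u u_xxx` for `x ∈ ℝ`, `t > 0`:
the derivatives that occur exist and are continuous, and the equation holds pointwise. -/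
structure IsClassicalSolution (ω : ℝ) (u : ℝ → ℝ → ℝ) : Prop where
  contDiff_x : ∀ t, 0 < t → ContDiff ℝ 3 (fun x => u x t)
  differentiable_t : ∀ x t, 0 < t → DifferentiableAt ℝ (fun s => u x s) t
  contDiff_t_x : ∀ t, 0 < t → ContDiff ℝ 2 (fun x => dt u x t)
  cont_u : ContinuousPosTime u
  cont_ux : ContinuousPosTime (dx u)
  cont_uxx : ContinuousPosTime (dx (dx u))
  cont_uxxx : ContinuousPosTime (dx (dx (dx u)))
  cont_ut : ContinuousPosTime (dt u)
  cont_utx : ContinuousPosTime (dx (dt u))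
  cont_utxx : ContinuousPosTime (dx (dx (dt u)))
  equation : ∀ x t, 0 < t →
    dt u x t - dx (dx (dt u)) x t + 2 * ω * dx u x t + 3 * u x t * dx u x t
      = 2 * dx u x t * dx (dx u) x t + u x t * dx (dx (dx u)) x t

/-- The step-like conditions with left limit `c` and right limit `0`: at each time `t ≥ 0`
the function `u(·, t)` tends to its limits, the momentum has two continuous `x`-derivatives,
and for each `T ≥ 0` the weighted integrals
`∫ (1 + |x|) ^ (l + 1) (|m - c H(-x)| + |m_x| + |m_xx|) dx` are bounded over `0 ≤ t ≤ T`. -/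
structure IsStepLike (c : ℝ) (l : ℕ) (u : ℝ → ℝ → ℝ) : Prop where
  contDiff_x : ∀ t, 0 ≤ t → ContDiff ℝ 4 (fun x => u x t)
  left_limit : ∀ t, 0 ≤ t → Tendsto (fun x => u x t) atBot (𝓝 c)
  right_limit : ∀ t, 0 ≤ t → Tendsto (fun x => u x t) atTop (𝓝 0)
  moment_bound : ∀ T : ℝ, 0 ≤ T → ∃ C : NNReal, ∀ t ∈ Icc (0 : ℝ) T,
    ∫⁻ x : ℝ, ENNReal.ofReal ((1 + |x|) ^ (l + 1) *
      (|momentum u x t - c * heaviside (-x)| + |dx (momentum u) x t|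
        + |dx (dx (momentum u)) x t|)) ≤ (C : ENNReal)

/-- The spectral parameter `λ = k ^ 2 + 1 / 4`. -/
def lam (k : ℂ) : ℂ := k ^ 2 + 1 / 4

/-- The number `c / (4 (c + ω))`, the square of the modulus of the branch points of `z(k)`. -/
def edge (ω c : ℝ) : ℝ := c / (4 * (c + ω))

/-- The closed segment that joins the branch points `± i √(c / (4 (c + ω)))`. -/
def cut (ω c : ℝ) : Set ℂ :=
  {k | ∃ s ∈ Icc (-√(edge ω c)) (√(edge ω c)), k = (s : ℂ) * Complex.I}

/-- The branch `z(k) = √(k ^ 2 + c / (4 (c + ω)))` off the cut, with `z(k) ~ k` as `k → ∞`. It is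
written as `k √(1 + c / (4 (c + ω) k ^ 2))` with the principal square root, whose argument is a
nonpositive real number only for `k` on the cut. -/
def zBranch (ω c : ℝ) (k : ℂ) : ℂ := k * (1 + (edge ω c : ℂ) / k ^ 2) ^ (1 / 2 : ℂ)

/-- `z` is a value of `z(k)`: off the cut this says `z = z(k)`, and for `k` on the cut that `z` is
one of the two boundary values `z(k ± 0)`. -/
def IsZValue (ω c : ℝ) (k z : ℂ) : Prop :=
  (k, z) ∈ closure {p : ℂ × ℂ | p.1 ∉ cut ω c ∧ p.2 = zBranch ω c p.1}

/-- `f` solves `(ω / (m + ω)) (- f'' + f / 4) = λ f` on the line, where `m` is the momentum of `u`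
at time `t`. -/
def SolvesXEquation (ω : ℝ) (u : ℝ → ℝ → ℝ) (lm : ℂ) (t : ℝ) (f : ℝ → ℂ) : Prop :=
  Differentiable ℝ f ∧ Differentiable ℝ (deriv f) ∧
    ∀ x, ((ω / (momentum u x t + ω) : ℝ) : ℂ) * (-deriv (deriv f) x + (1 / 4) * f x) = lm * f x

/-- `φ(x, t)` is the right Jost solution `φ₊(x, t; k)`. -/
def IsJostPlus (ω : ℝ) (u : ℝ → ℝ → ℝ) (k : ℂ) (φ : ℝ → ℝ → ℂ) : Prop :=
  ∀ t, 0 ≤ t → SolvesXEquation ω u (lam k) t (fun x => φ x t) ∧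
    Tendsto (fun x : ℝ =>
      Complex.exp (-Complex.I * k * x + Complex.I * ω * k * t / (2 * lam k)) * φ x t)
      atTop (𝓝 1)

/-- `φ(x, t)` is the left Jost solution `φ₋(x, t; k)`, where `z` is the value of `z(k)` (on the cut,
the boundary value on the chosen side). -/
def IsJostMinus (ω c : ℝ) (u : ℝ → ℝ → ℝ) (k z : ℂ) (φ : ℝ → ℝ → ℂ) : Prop :=
  ∀ t, 0 ≤ t → SolvesXEquation ω u (lam k) t (fun x => φ x t) ∧
    Tendsto (fun x : ℝ =>
      ((((c + ω) / ω) ^ (1 / 4 : ℝ) : ℝ) : ℂ) *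
        Complex.exp (Complex.I * z * (√((c + ω) / ω) : ℝ) * (x - (c + ω / (2 * lam k)) * t)) *
        φ x t)
      atBot (𝓝 1)

/-- `φ` has a time derivative for `t > 0` and satisfies
`φ_t = - (ω / (2 λ) + u) φ_x + (u_x / 2) φ`. -/
def SolvesTEquation (ω : ℝ) (u : ℝ → ℝ → ℝ) (lm : ℂ) (φ : ℝ → ℝ → ℂ) : Prop :=
  ∀ x t, 0 < t → HasDerivAt (fun s => φ x s)
    (-((ω : ℂ) / (2 * lm) + (u x t : ℂ)) * deriv (fun y => φ y t) x
      + ((dx u x t : ℝ) : ℂ) / 2 * φ x t) t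

end CamassaHolm

end

/-! The claimed equation is the time half of the Lax pair of the Camassa–Holm equation. Nothing is
known beforehand about how a Jost solution `φ` depends on time, so a second function `Φ` is built
and then identified with `φ`. At a time `a` slightly before the given one, the vector `(φ, φ_x)` is
taken at each `x` as initial value of the linear system `Φ_t = V Φ`, whose first row is the claimed
equation.

Three facts give `φ = Φ.1`. By zero curvature, `Φ` still solves the spectral problem at later times
(`hasDerivAt_of_zero_curvature`, `lax_zero_curvature`). As `u` tends to its limit uniformly in time,
`V` tends to a constant matrix, so the rescaled `Φ` keeps the normalization of the Jost solution
(`tendsto_smul_flow`). Finally, a solution of the spectral problem is determined by its limit after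
rescaling by an exponential of modulus at least one, by constancy of the Wronskian
(`eq_zero_of_tendsto_zero`). All this is assembled in `solvesTEquation_of_jost`, which serves both
ends of the line.

Uniformity in time comes from the weighted integral bound: it controls `m` pointwise, a maximum
principle for `u - u_xx = m` transfers the decay to `u`, and then `u_xx` and `u_x` follow
(`IsStepLike.asymptoticTo`). -/

section LinearFlow

/-! ### Linear flows in time and the zero curvature condition. -/

variable {E : Type*} [NormedAddCommGroup E] [NormedSpace ℝ E]

/-- A simplified form of Grönwall's inequality that is linear in the initial value and in the
forcing. -/
theorem norm_le_of_norm_derivWithin_le {f f' : ℝ → E} {δ K ε a b : ℝ} (hK : 0 ≤ K) (hε : 0 ≤ ε)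
    (hf : ∀ t ∈ Icc a b, HasDerivWithinAt f (f' t) (Icc a b) t) (ha : ‖f a‖ ≤ δ)
    (bound : ∀ t ∈ Icc a b, ‖f' t‖ ≤ K * ‖f t‖ + ε) :
    ∀ t ∈ Icc a b, ‖f t‖ ≤ (δ + ε) * Real.exp ((K + 1) * (b - a)) := by
  intro t ht
  have hδ : 0 ≤ δ := (norm_nonneg _).trans ha
  -- The rate `K + 1` replaces `K` to avoid the degenerate case of rate zero and to make `ε / (K +
  -- 1) ≤ ε`.
  have h := norm_le_gronwallBound_of_norm_deriv_right_le (f := f) (f' := f') (δ := δ) (K := K + 1)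
    (ε := ε) (a := a) (b := b) (fun s hs => (hf s hs).continuousWithinAt)
    (fun s hs => (hf s ⟨hs.1, hs.2.le⟩).mono_of_mem_nhdsWithin (Icc_mem_nhdsGE_of_mem hs)) ha
    (fun s hs => (bound s ⟨hs.1, hs.2.le⟩).trans (by nlinarith [norm_nonneg (f s)])) t ht
  rw [gronwallBound_of_K_ne_0 (by positivity)] at h
  have hexp : Real.exp ((K + 1) * (t - a)) ≤ Real.exp ((K + 1) * (b - a)) := by
    gcongr; exact ht.2
  have h1 : 1 ≤ Real.exp ((K + 1) * (t - a)) :=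
    Real.one_le_exp (mul_nonneg (by positivity) (by linarith [ht.1]))
  have h2 : ε / (K + 1) ≤ ε := div_le_self hε (by linarith)
  have h3 : ε / (K + 1) * (Real.exp ((K + 1) * (t - a)) - 1)
      ≤ ε * Real.exp ((K + 1) * (t - a)) :=
    mul_le_mul h2 (by linarith) (by linarith) hε
  calc ‖f t‖ ≤ (δ + ε) * Real.exp ((K + 1) * (t - a)) := by linarith
    _ ≤ _ := by gcongr

/-- A linear equation has a solution on an interval that is short in terms of the bound on the
coefficient. -/
theorem exists_linear_flow [CompleteSpace E] {A : ℝ → E →L[ℝ] E} {a b M : ℝ} (hab : a ≤ b)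
    (hA : ContinuousOn A (Icc a b)) (hM : ∀ t ∈ Icc a b, ‖A t‖ ≤ M) (hMab : M * (b - a) ≤ 1 / 2)
    (y : E) :
    ∃ f : ℝ → E, f a = y ∧ ∀ t ∈ Icc a b, HasDerivWithinAt f (A t (f t)) (Icc a b) t := by
  have hM0 : 0 ≤ M := (norm_nonneg _).trans (hM a ⟨le_rfl, hab⟩)
  lift M to NNReal using hM0
  -- On the ball of radius `‖y‖` about `y` vectors have norm at most `2‖y‖`, so the speed is at most
  -- `2M‖y‖`; since `M (b - a) ≤ 1/2`, the solution cannot leave the ball.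
  have hPL : IsPicardLindelof (fun t x => A t x) (⟨a, le_rfl, hab⟩ : Icc a b) y ‖y‖₊ 0
      (M * (2 * ‖y‖₊)) M := by
    refine ⟨fun t ht => ?_, fun x _ => ?_, fun t ht x hx => ?_, ?_⟩
    · refine ((A t).lipschitz.weaken ?_).lipschitzOnWith
      exact_mod_cast hM t ht
    · exact hA.clm_apply continuousOn_const
    · refine ((A t).le_opNorm x).trans ?_
      push_cast
      have : ‖x‖ ≤ 2 * ‖y‖ := by
        have := norm_le_of_mem_closedBall hx
        simp at this; linarith
      exact mul_le_mul (hM t ht) this (norm_nonneg _) M.2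
    · push_cast
      rw [max_eq_left (by simpa using hab)]
      nlinarith [norm_nonneg y]
  obtain ⟨f, hf, hf'⟩ := hPL.exists_eq_forall_mem_Icc_hasDerivWithinAt₀
  exact ⟨f, hf, hf'⟩

/-- A first-order Taylor estimate, uniform in a compact parameter. -/
theorem eventually_norm_taylor_le {F : Type*} [NormedAddCommGroup F] [NormedSpace ℝ F]
    {V Vx : ℝ → ℝ → F} {a b x : ℝ}
    (hV : ∀ y, ∀ t ∈ Icc a b, HasDerivAt (fun y => V y t) (Vx y t) y)
    (hVx : ContinuousOn (Function.uncurry Vx) (univ ×ˢ Icc a b)) {ε : ℝ} (hε : 0 < ε) :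
    ∀ᶠ y in 𝓝 x, ∀ t ∈ Icc a b, ‖V y t - V x t - (y - x) • Vx x t‖ ≤ ε * |y - x| := by
  obtain ⟨v, hv, H⟩ := isCompact_Icc.mem_uniformity_of_prod hVx (mem_univ x)
    (Metric.dist_mem_uniformity hε)
  rw [nhdsWithin_univ] at hv
  obtain ⟨r, hr, hrv⟩ := Metric.mem_nhds_iff.1 hv
  filter_upwards [Metric.ball_mem_nhds x hr] with y hy t ht
  have key := (convex_ball x r).norm_image_sub_le_of_norm_hasDerivWithin_le
    (f := fun z => V z t - z • Vx x t) (f' := fun z => Vx z t - Vx x t) (C := ε)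
    (fun z _ => ((hV z t ht).sub
      (by simpa using (hasDerivAt_id z).smul_const (Vx x t))).hasDerivWithinAt)
    (fun z hz => by
      have := H z (hrv hz) t ht
      simp only [mem_ofPred_eq, dist_eq_norm] at this
      exact this.le) (Metric.mem_ball_self hr) hy
  convert! key using 2
  module

/-- If the zero curvature condition `V_x + V U = U_t + U V` holds and `Φ` solves `Φ_t = V Φ`,
then the equation `Φ_x = U Φ` propagates from the initial time. -/
theorem hasDerivAt_of_zero_curvature {U V Ut Vx : ℝ → ℝ → E →L[ℝ] E} {a b M : ℝ}
    (hV : ∀ y, ∀ t ∈ Icc a b, HasDerivAt (fun y => V y t) (Vx y t) y)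
    (hVx : ContinuousOn (Function.uncurry Vx) (univ ×ˢ Icc a b))
    (hU : ∀ y, ∀ t ∈ Icc a b, HasDerivWithinAt (U y) (Ut y t) (Icc a b) t)
    (hflat : ∀ y, ∀ t ∈ Icc a b, Vx y t + V y t ∘L U y t = Ut y t + U y t ∘L V y t)
    (hM : ∀ y, ∀ t ∈ Icc a b, ‖V y t‖ ≤ M)
    {Φ : ℝ → ℝ → E}
    (hΦ : ∀ y, ∀ t ∈ Icc a b, HasDerivWithinAt (Φ y) (V y t (Φ y t)) (Icc a b) t)
    (hΦa : ∀ y, HasDerivAt (fun y => Φ y a) (U y a (Φ y a)) y) :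
    ∀ x, ∀ t ∈ Icc a b, HasDerivAt (fun y => Φ y t) (U x t (Φ x t)) x := by
  intro x t ht
  have hab : a ≤ b := ht.1.trans ht.2
  have hM0 : 0 ≤ M := (norm_nonneg _).trans (hM x t ht)
  have hcΦ : ContinuousOn (Φ x) (Icc a b) := fun s hs => (hΦ x s hs).continuousWithinAt
  have hcU : ContinuousOn (U x) (Icc a b) := fun s hs => (hU x s hs).continuousWithinAt
  have hcV : ContinuousOn (Vx x) (Icc a b) :=
    hVx.comp (f := fun s => (x, s)) (by fun_prop) (fun s hs => ⟨trivial, hs⟩)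
  obtain ⟨C₁, hC₁⟩ := isCompact_Icc.exists_bound_of_continuousOn hcΦ
  obtain ⟨C₂, hC₂⟩ := isCompact_Icc.exists_bound_of_continuousOn (hcU.clm_apply hcΦ)
  obtain ⟨C₃, hC₃⟩ := isCompact_Icc.exists_bound_of_continuousOn hcV
  have hC₁0 := (norm_nonneg _).trans (hC₁ t ht)
  have hC₂0 := (norm_nonneg _).trans (hC₂ t ht)
  have hC₃0 := (norm_nonneg _).trans (hC₃ t ht)
  rw [hasDerivAt_iff_isLittleO, Asymptotics.isLittleO_iff]
  intro ε hε
  set G := Real.exp ((M + 1) * (b - a)) with hG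
  have hG0 : 0 < G := Real.exp_pos _
  -- Chosen so that `η / 2 * C₁ ≤ ε / (4 G)`: the initial error and the two forcing terms then
  -- contribute `ε / 4` each after Grönwall.
  set η := ε / (2 * G * (C₁ + 1)) with hη
  have hη0 : 0 < η := by positivity
  have hsmall : ∀ᶠ y in 𝓝 x, (C₃ + η) * C₂ * |y - x| ≤ ε / (4 * G) := by
    have : Tendsto (fun y => (C₃ + η) * C₂ * |y - x|) (𝓝 x) (𝓝 ((C₃ + η) * C₂ * |x - x|)) :=
      Continuous.tendsto (by fun_prop) x
    rw [sub_self, abs_zero, mul_zero] at this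
    exact (this.eventually_lt_const (by positivity)).mono fun _ h => h.le
  have h0 := (hasDerivAt_iff_isLittleO.1 (hΦa x))
  rw [Asymptotics.isLittleO_iff] at h0
  filter_upwards [eventually_norm_taylor_le (x := x) hV hVx (ε := η / 2) (by positivity), hsmall,
    h0 (c := ε / (4 * G)) (by positivity)] with y hy1 hy2 hy3
  -- Grönwall is applied in time to the spatial Taylor remainder of `Φ`, which is `o(|y - x|)` at
  -- time `a`.
  have key := norm_le_of_norm_derivWithin_le (a := a) (b := b) (K := M) (δ := ε / (4 * G) * |y - x|)
    (ε := (η / 2 * C₁ + ε / (4 * G)) * |y - x|)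
    (f := fun s => Φ y s - Φ x s - (y - x) • U x s (Φ x s))
    (f' := fun s => V y s (Φ y s) - V x s (Φ x s)
      - (y - x) • (Ut x s (Φ x s) + U x s (V x s (Φ x s))))
    hM0 (by positivity)
    (fun s hs => ((hΦ y s hs).sub (hΦ x s hs)).sub
      (((hU x s hs).clm_apply (hΦ x s hs)).const_smul (y - x)))
    hy3 (fun s hs => ?_) t ht
  · refine key.trans ?_
    rw [Real.norm_eq_abs]
    have h1 : η / 2 * C₁ ≤ ε / (4 * G) := by
      rw [hη, div_div, div_mul_eq_mul_div, div_le_div_iff₀ (by positivity) (by positivity)]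
      nlinarith [mul_pos hε hG0]
    calc _ ≤ (ε / (4 * G) * |y - x| + (ε / (4 * G) + ε / (4 * G)) * |y - x|) * G := by
          gcongr
      _ = 3 / 4 * ε * |y - x| := by field_simp; ring
      _ ≤ ε * |y - x| := by
        have := mul_nonneg hε.le (abs_nonneg (y - x)); linarith
  · have e1 : Ut x s (Φ x s) + U x s (V x s (Φ x s)) = Vx x s (Φ x s) + V x s (U x s (Φ x s)) := by
      have := congrArg (fun L => L (Φ x s)) (hflat x s hs)
      simpa using this.symm
    have e2 : V y s (Φ y s) - V x s (Φ x s)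
        - (y - x) • (Ut x s (Φ x s) + U x s (V x s (Φ x s)))
        = V y s (Φ y s - Φ x s - (y - x) • U x s (Φ x s))
          + (V y s - V x s - (y - x) • Vx x s) (Φ x s)
          + (y - x) • (V y s - V x s) (U x s (Φ x s)) := by
      rw [e1]
      simp only [map_sub, map_smul, sub_apply, smul_apply]
      module
    have n1 : ‖V y s - V x s‖ ≤ (C₃ + η) * |y - x| := by
      have h1 := hy1 s hs
      have h2 : V y s - V x s = (V y s - V x s - (y - x) • Vx x s) + (y - x) • Vx x s := by abel
      rw [h2]
      refine (norm_add_le _ _).trans ?_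
      rw [norm_smul, Real.norm_eq_abs]
      have := mul_le_mul_of_nonneg_left (hC₃ s hs) (abs_nonneg (y - x))
      nlinarith [abs_nonneg (y - x)]
    rw [e2]
    have n2 : ‖(y - x) • (V y s - V x s) (U x s (Φ x s))‖ ≤ ε / (4 * G) * |y - x| := by
      rw [norm_smul, Real.norm_eq_abs]
      calc |y - x| * ‖(V y s - V x s) (U x s (Φ x s))‖
          ≤ |y - x| * ((C₃ + η) * |y - x| * C₂) := by
            gcongr
            exact (ContinuousLinearMap.le_opNorm _ _).trans
              (mul_le_mul n1 (hC₂ s hs) (norm_nonneg _) (by positivity))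
        _ = ((C₃ + η) * C₂ * |y - x|) * |y - x| := by ring
        _ ≤ _ := by gcongr
    have n3 : ‖(V y s - V x s - (y - x) • Vx x s) (Φ x s)‖ ≤ η / 2 * |y - x| * C₁ :=
      (ContinuousLinearMap.le_opNorm _ _).trans
        (mul_le_mul (hy1 s hs) (hC₁ s hs) (norm_nonneg _) (by positivity))
    have n4 := ((V y s).le_opNorm (Φ y s - Φ x s - (y - x) • U x s (Φ x s))).trans
      (mul_le_mul_of_nonneg_right (hM y s hs) (norm_nonneg _))
    refine (norm_add₃_le).trans ?_
    linarith

end LinearFlow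

/-- Solutions of `Φ_t = V Φ`, rescaled by `e(x)`, keep a limit as `x` tends along `l` if the
coefficient tends to a limit coefficient, uniformly in time. -/
theorem tendsto_smul_flow {E : Type*} [NormedAddCommGroup E] [NormedSpace ℂ E] {l : Filter ℝ}
    {V : ℝ → ℝ → E →L[ℝ] E} {V₀ : E →L[ℝ] E} {a b M : ℝ}
    (hVsmul : ∀ y t (z : ℂ) v, V y t (z • v) = z • V y t v)
    (hM : ∀ y, ∀ t ∈ Icc a b, ‖V y t‖ ≤ M)
    (hV : ∀ ε > 0, ∀ᶠ y in l, ∀ t ∈ Icc a b, ‖V y t - V₀‖ ≤ ε)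
    {Φ : ℝ → ℝ → E} {W : ℝ → E} {e : ℝ → ℂ}
    (hΦ : ∀ y, ∀ t ∈ Icc a b, HasDerivWithinAt (Φ y) (V y t (Φ y t)) (Icc a b) t)
    (hW : ∀ t ∈ Icc a b, HasDerivWithinAt W (V₀ (W t)) (Icc a b) t)
    (ha : Tendsto (fun y => e y • Φ y a) l (𝓝 (W a))) {t : ℝ} (ht : t ∈ Icc a b) :
    Tendsto (fun y => e y • Φ y t) l (𝓝 (W t)) := by
  have hM0 : 0 ≤ M := (norm_nonneg _).trans (hM 0 t ht)
  obtain ⟨C, hC⟩ := isCompact_Icc.exists_bound_of_continuousOn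
    (fun s hs => (hW s hs).continuousWithinAt : ContinuousOn W (Icc a b))
  have hC0 := (norm_nonneg _).trans (hC t ht)
  rw [Metric.tendsto_nhds] at ha ⊢
  intro ε hε
  set G := Real.exp ((M + 1) * (b - a))
  have hG0 : 0 < G := Real.exp_pos _
  filter_upwards [ha (ε / (4 * G)) (by positivity), hV (ε / (4 * G * (C + 1))) (by positivity)]
    with y hy1 hy2
  rw [dist_eq_norm] at hy1 ⊢
  have key := norm_le_of_norm_derivWithin_le (a := a) (b := b) (K := M) (δ := ε / (4 * G))
    (ε := ε / (4 * G * (C + 1)) * C)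
    (f := fun s => e y • Φ y s - W s) (f' := fun s => e y • V y s (Φ y s) - V₀ (W s)) hM0
    (by positivity) (fun s hs => ((hΦ y s hs).const_smul (e y)).sub (hW s hs)) hy1.le
    (fun s hs => ?_) t ht
  · refine key.trans_lt ?_
    have : ε / (4 * G * (C + 1)) * C ≤ ε / (4 * G) := by
      rw [div_mul_eq_mul_div, div_le_div_iff₀ (by positivity) (by positivity)]
      nlinarith [mul_pos hε hG0]
    calc _ ≤ (ε / (4 * G) + ε / (4 * G)) * G := by gcongr
      _ = ε / 2 := by field_simp; ring
      _ < ε := by linarith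
  -- The factor `e y` is unbounded in general, but it is constant in time and commutes with `V`; the
  -- forcing then involves only the bounded `W`.
  · have : e y • V y s (Φ y s) - V₀ (W s) = V y s (e y • Φ y s - W s) + (V y s - V₀) (W s) := by
      simp [hVsmul]
    rw [this]
    refine (norm_add_le _ _).trans (add_le_add ?_ ?_)
    · exact (ContinuousLinearMap.le_opNorm _ _).trans
        (mul_le_mul_of_nonneg_right (hM y s hs) (norm_nonneg _))
    · exact (ContinuousLinearMap.le_opNorm _ _).trans
        (mul_le_mul (hy2 s hs) (hC s hs) (norm_nonneg _) (by positivity))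

/-- Differentiation in `t > 0` and in `x` commute, if the mixed derivative `∂_x ∂_t` is jointly
continuous. -/
theorem hasDerivAt_deriv_comm {g gt gx gtx : ℝ → ℝ → ℝ}
    (hgt : ∀ y s, 0 < s → HasDerivAt (g y) (gt y s) s)
    (hgx : ∀ y s, 0 < s → HasDerivAt (fun y => g y s) (gx y s) y)
    (hgtx : ∀ y s, 0 < s → HasDerivAt (fun y => gt y s) (gtx y s) y)
    (hc : ContinuousOn (fun p : ℝ × ℝ => gtx p.1 p.2) {p | 0 < p.2}) {x t : ℝ} (ht : 0 < t) :
    HasDerivAt (gx x) (gtx x t) t := by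
  rw [hasDerivAt_iff_isLittleO, Asymptotics.isLittleO_iff]
  intro ε hε
  have hcont : ContinuousAt (fun p : ℝ × ℝ => gtx p.1 p.2) (x, t) :=
    hc.continuousAt ((isOpen_lt continuous_const continuous_snd).mem_nhds ht)
  obtain ⟨r, hr, hrε⟩ := Metric.continuousAt_iff.1 hcont ε hε
  filter_upwards [Metric.ball_mem_nhds t (lt_min hr ht)] with s hs
  rw [Metric.mem_ball, lt_min_iff] at hs
  have hball : ∀ s' ∈ uIcc t s, 0 < s' ∧ dist s' t < r := by
    intro s' hs'
    have : dist s' t ≤ dist s t := by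
      rw [Real.dist_eq, Real.dist_eq, abs_sub_comm s' t, abs_sub_comm s t]
      simpa [abs_sub_comm] using abs_sub_left_of_mem_uIcc hs'
    refine ⟨?_, this.trans_lt hs.1⟩
    have := (this.trans_lt hs.2)
    rw [Real.dist_eq, abs_lt] at this
    linarith [this.1]
  -- the increment in time has a spatial difference quotient close to `(s - t) * gtx x t`
  have hinc : ∀ y, dist y x < r →
      |(g y s - g y t - (s - t) * (y * gtx x t)) - (g x s - g x t - (s - t) * (x * gtx x t))|
        ≤ ε * |s - t| * |y - x| := by
    intro y hy
    have h1 : ∀ s' ∈ uIcc t s, |gt y s' - gt x s' - (y - x) * gtx x t| ≤ ε * |y - x| := by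
      intro s' hs'
      have key := (convex_ball x r).norm_image_sub_le_of_norm_hasDerivWithin_le
        (f := fun z => gt z s' - z * gtx x t) (f' := fun z => gtx z s' - gtx x t) (C := ε)
        (fun z _ => ((hgtx z s' (hball s' hs').1).sub
          (by simpa using (hasDerivAt_id z).mul_const (gtx x t))).hasDerivWithinAt)
        (fun z hz => by
          have := @hrε (z, s') (by
            rw [Prod.dist_eq]; exact max_lt hz (hball s' hs').2)
          exact (by simpa [dist_eq_norm] using this.le))
        (Metric.mem_ball_self hr) hy
      convert! key using 2
      ring
    have key := (convex_uIcc t s).norm_image_sub_le_of_norm_hasDerivWithin_le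
        (f := fun s' => g y s' - g x s' - s' * ((y - x) * gtx x t))
        (f' := fun s' => gt y s' - gt x s' - (y - x) * gtx x t) (C := ε * |y - x|)
        (fun s' hs' => (((hgt y s' (hball s' hs').1).sub (hgt x s' (hball s' hs').1)).sub
          (by simpa using (hasDerivAt_id s').mul_const ((y - x) * gtx x t))).hasDerivWithinAt)
        h1 left_mem_uIcc right_mem_uIcc
    calc _ = ‖(g y s - g x s - s * ((y - x) * gtx x t))
          - (g y t - g x t - t * ((y - x) * gtx x t))‖ := by
            rw [Real.norm_eq_abs]; congr 1; ring
      _ ≤ _ := key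
      _ = _ := by rw [Real.norm_eq_abs]; ring
  -- The derivative at `x` of the function estimated in `hinc` is the Taylor remainder of `gx` in
  -- time, and a Lipschitz bound at `x` bounds that derivative.
  have hd : HasDerivAt (fun y => g y s - g y t - (s - t) * (y * gtx x t))
      (gx x s - gx x t - (s - t) * gtx x t) x :=
    ((hgx x s (hball s right_mem_uIcc).1).sub (hgx x t ht)).sub
      (by simpa using ((hasDerivAt_id x).mul_const (gtx x t)).const_mul (s - t))
  have := hd.le_of_lip' (C := ε * |s - t|) (by positivity) (by
    filter_upwards [Metric.ball_mem_nhds x hr] with y hy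
    exact hinc y hy)
  simpa using this

/-! ### Asymptotics and uniqueness for second-order equations. -/

/-- A filter on the line such that everything that holds eventually holds eventually on the unit
interval to the right of the point. -/
def Filter.UnitStable (l : Filter ℝ) : Prop :=
  ∀ P : ℝ → Prop, (∀ᶠ x in l, P x) → ∀ᶠ x in l, ∀ y ∈ Icc x (x + 1), P y

theorem unitStable_atTop : (atTop : Filter ℝ).UnitStable := by
  intro P hP
  obtain ⟨X, hX⟩ := eventually_atTop.1 hP
  filter_upwards [eventually_ge_atTop X] with x hx y hy using hX y (hx.trans hy.1)

theorem unitStable_atBot : (atBot : Filter ℝ).UnitStable := by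
  intro P hP
  obtain ⟨X, hX⟩ := eventually_atBot.1 hP
  filter_upwards [eventually_le_atBot (X - 1)] with x hx y hy using hX y (by linarith [hy.2])

/-- If `y` has a limit and `(y' + κ y)'` tends to zero, then `y'` tends to zero. -/
theorem tendsto_deriv_zero_of_tendsto {l : Filter ℝ} (hl : l.UnitStable) {y y' y'' : ℝ → ℂ}
    {κ L : ℂ} (hy : ∀ x, HasDerivAt y (y' x) x) (hy' : ∀ x, HasDerivAt y' (y'' x) x)
    (hlim : Tendsto y l (𝓝 L)) (hlim' : Tendsto (fun x => y'' x + κ * y' x) l (𝓝 0)) :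
    Tendsto y' l (𝓝 0) := by
  rw [Metric.tendsto_nhds] at hlim hlim' ⊢
  intro ε hε
  set η := ε / (4 * (‖κ‖ + 1)) with hη
  have hη0 : 0 < η := by positivity
  filter_upwards [hl _ (hlim η hη0), hl _ (hlim' (ε / 4) (by positivity))] with x hx hx'
  have hdist : ∀ ξ ∈ Icc x (x + 1), ‖y ξ - y x‖ ≤ 2 * η := fun ξ hξ => by
    have h1 := hx ξ hξ
    have h2 := hx x ⟨le_rfl, by linarith⟩
    rw [← dist_eq_norm]
    linarith [dist_triangle_right (y ξ) (y x) L]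
  have hη1 : (‖κ‖ + 1) * η = ε / 4 := by rw [hη]; field_simp
  -- On a unit interval `y' + κ y` and `y` vary little, hence so does `y'`; it is therefore close to
  -- its mean `y (x + 1) - y x`, which is small.
  have hp : ∀ ξ ∈ Icc x (x + 1), ‖y' ξ - y' x‖ ≤ ε / 4 + ‖κ‖ * (2 * η) := fun ξ hξ => by
    have key := (convex_Icc x (x + 1)).norm_image_sub_le_of_norm_hasDerivWithin_le
      (f := fun z => y' z + κ * y z) (f' := fun z => y'' z + κ * y' z) (C := ε / 4)
      (fun z _ => ((hy' z).add ((hy z).const_mul κ)).hasDerivWithinAt)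
      (fun z hz => by simpa using (hx' z hz).le) ⟨le_rfl, by linarith⟩ hξ
    have h1 : y' ξ - y' x = (y' ξ + κ * y ξ - (y' x + κ * y x)) - κ * (y ξ - y x) := by ring
    rw [h1]
    refine (norm_sub_le _ _).trans (add_le_add (key.trans ?_) ?_)
    · rw [Real.norm_eq_abs, abs_of_nonneg (by linarith [hξ.1])]
      have : ξ - x ≤ 1 := by linarith [hξ.2]
      nlinarith
    · rw [norm_mul]
      exact mul_le_mul_of_nonneg_left (hdist ξ hξ) (norm_nonneg _)
  have key := (convex_Icc x (x + 1)).norm_image_sub_le_of_norm_hasDerivWithin_le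
    (f := fun z : ℝ => y z - (z : ℂ) * y' x) (f' := fun z => y' z - y' x)
    (fun z _ => ((hy z).sub (by
      simpa using (Complex.ofRealCLM.hasDerivAt (x := z)).mul_const (y' x))).hasDerivWithinAt)
    hp (x := x) (y := x + 1) ⟨le_rfl, by linarith⟩ ⟨by linarith, le_rfl⟩
  have h1 : y' x = (y (x + 1) - y x)
      - ((y (x + 1) - ((x + 1 : ℝ) : ℂ) * y' x) - (y x - (x : ℂ) * y' x)) := by
    push_cast; ring
  rw [dist_zero_right, h1]
  refine (norm_sub_le _ _).trans_lt ?_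
  have h2 := hdist (x + 1) ⟨by linarith, le_rfl⟩
  simp only [add_sub_cancel_left, norm_one, mul_one] at key
  nlinarith [norm_nonneg κ]

/-- Uniqueness of a solution of `y'' = r y` with prescribed asymptotics. -/
theorem eq_zero_of_tendsto_zero {l : Filter ℝ} [l.NeBot] {r : ℝ → ℂ} {K : NNReal}
    (hr : ∀ x, ‖r x‖ ≤ K) {f f' h h' e : ℝ → ℂ} {A B : ℂ}
    (hf : ∀ x, HasDerivAt f (f' x) x) (hf' : ∀ x, HasDerivAt f' (r x * f x) x)
    (hh : ∀ x, HasDerivAt h (h' x) x) (hh' : ∀ x, HasDerivAt h' (r x * h x) x)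
    (he : ∀ᶠ x in l, 1 ≤ ‖e x‖) (hA : A ≠ 0)
    (hfl : Tendsto (fun x => e x * f x) l (𝓝 A)) (hfl' : Tendsto (fun x => e x * f' x) l (𝓝 B))
    (hhl : Tendsto (fun x => e x * h x) l (𝓝 0))
    (hhl' : Tendsto (fun x => e x * h' x) l (𝓝 0)) : ∀ x, h x = 0 := by
  -- The Wronskian of `f` and `h` is constant.
  have hw : ∀ x y, f x * h' x - f' x * h x = f y * h' y - f' y * h y := by
    refine is_const_of_deriv_eq_zero (f := fun x => f x * h' x - f' x * h x)
      (fun x => (((hf x).mul (hh' x)).sub ((hf' x).mul (hh x))).differentiableAt) fun x => ?_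
    refine (((hf x).mul (hh' x)).sub ((hf' x).mul (hh x))).deriv.trans ?_
    ring
  have hw0 : ∀ x, f x * h' x - f' x * h x = 0 := by
    intro x
    -- The Wronskian times `e²` tends to zero while `|e| ≥ 1`, so the Wronskian vanishes and `h` is
    -- a multiple of `f`.
    have h1 := (hfl.mul hhl').sub (hfl'.mul hhl)
    simp only [mul_zero, sub_zero] at h1
    have h2 : ‖f x * h' x - f' x * h x‖ ≤ 0 := by
      have h3 := h1.norm
      rw [norm_zero] at h3
      refine ge_of_tendsto h3 ?_
      filter_upwards [he] with y hy
      rw [hw x y]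
      have : e y * f y * (e y * h' y) - e y * f' y * (e y * h y)
        = e y * e y * (f y * h' y - f' y * h y) := by ring
      rw [this, norm_mul, norm_mul]
      exact le_mul_of_one_le_left (norm_nonneg _) (one_le_mul_of_one_le_of_one_le hy hy)
    simpa using h2
  obtain ⟨x₀, hx₀⟩ := (hfl.eventually_ne hA).exists
  have hfx₀ : f x₀ ≠ 0 := right_ne_zero_of_mul hx₀
  set C := h x₀ / f x₀ with hC
  have hE : (fun x => (h x, h' x)) = fun x => (C * f x, C * f' x) := by
    refine ODE_solution_unique_univ (K := max 1 K) (t₀ := x₀) (s := fun _ => univ)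
      (v := fun x p => (p.2, r x * p.1)) (fun x => ?_)
      (fun x => ⟨(hh x).prodMk (hh' x), trivial⟩)
      (fun x => ⟨((hf x).const_mul C).prodMk (?_), trivial⟩) ?_
    · refine (LipschitzWith.prodMk LipschitzWith.prod_snd ?_).lipschitzOnWith
      refine LipschitzWith.of_dist_le_mul fun p q => ?_
      rw [dist_eq_norm, ← mul_sub, norm_mul, ← dist_eq_norm]
      exact mul_le_mul (hr x) (by rw [Prod.dist_eq]; exact le_max_left _ _) dist_nonneg K.2
    · convert! (hf' x).const_mul C using 1
      ring
    · have := hw0 x₀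
      ext
      · simp [hC, hfx₀]
      · simp only [hC]
        field_simp
        linear_combination this
  have hhC : ∀ x, h x = C * f x := fun x => congrArg Prod.fst (congrFun hE x)
  -- `e f` has the nonzero limit `A`, whereas `e h` tends to zero.
  have hC0 : C = 0 := by
    have h1 : Tendsto (fun x => e x * h x) l (𝓝 (C * A)) := by
      refine (hfl.const_mul C).congr fun x => ?_
      rw [hhC x]; ring
    simpa [hA] using tendsto_nhds_unique h1 hhl
  intro x
  simp [hhC x, hC0]

/-! ### Maximum principle and Sobolev bounds on the line. -/

/-- A comparison principle on a half-line: a function that is strictly convex where it is positive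
cannot be positive if it is nonpositive at the boundary and at infinity. -/
theorem nonpos_of_deriv_pos_of_pos {f f' f'' : ℝ → ℝ} {R : ℝ}
    (hf : ∀ x, HasDerivAt f (f' x) x) (hf' : ∀ x, HasDerivAt f' (f'' x) x)
    (hpos : ∀ x, R < x → 0 < f x → 0 < f'' x) (hR : f R ≤ 0)
    (hlim : ∀ ε > 0, ∀ᶠ x in atTop, f x ≤ ε) : ∀ x, R ≤ x → f x ≤ 0 := by
  intro x₁ hx₁
  by_contra! hlt
  have hRx : R < x₁ := lt_of_le_of_ne hx₁ (by rintro rfl; linarith)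
  obtain ⟨b, hb⟩ := eventually_atTop.1 (hlim (f x₁ / 2) (by positivity))
  set B := max b (x₁ + 1)
  have hcont : Continuous f := continuous_iff_continuousAt.2 fun x => (hf x).continuousAt
  obtain ⟨x₀, hx₀, hmax⟩ := isCompact_Icc.exists_isMaxOn (s := Icc R B)
    ⟨x₁, hx₁, (by linarith : x₁ ≤ x₁ + 1).trans (le_max_right _ _)⟩ hcont.continuousOn
  have h1 : f x₁ ≤ f x₀ := hmax ⟨hx₁, (by linarith : x₁ ≤ x₁ + 1).trans (le_max_right _ _)⟩
  have h0R : R < x₀ := lt_of_le_of_ne hx₀.1 (by rintro rfl; linarith)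
  have h0B : x₀ < B := lt_of_le_of_ne hx₀.2 (by
    rintro h; have := hb B (le_max_left _ _); rw [← h] at this; linarith)
  have hloc : IsLocalMax f x₀ := hmax.isLocalMax (Icc_mem_nhds h0R h0B)
  have hd : deriv f = f' := funext fun x => (hf x).deriv
  have hd2 : deriv (deriv f) = f'' := by rw [hd]; exact funext fun x => (hf' x).deriv
  have hpos0 := hpos x₀ h0R (hlt.trans_le h1)
  -- A positive interior maximum has `f'' > 0` and is thus also a local minimum; `f` is then locally
  -- constant, which contradicts `f'' > 0`.
  have hmin : IsLocalMin f x₀ := isLocalMin_of_deriv_deriv_pos (by rwa [hd2]) hloc.deriv_eq_zero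
    (hf x₀).continuousAt
  have heq : f =ᶠ[𝓝 x₀] fun _ => f x₀ := by
    filter_upwards [hloc, hmin] with x hx hx' using le_antisymm hx hx'
  have h2 : deriv f =ᶠ[𝓝 x₀] fun _ => 0 := by
    simpa using heq.deriv
  have h3 := h2.deriv_eq
  rw [hd2] at h3
  simp at h3
  linarith

/-- A bound for `u` on a half-line in terms of `u - u''`, where `u` tends to zero. -/
theorem abs_le_add_exp_of_abs_sub_deriv_le {u u' u'' : ℝ → ℝ} {R ε B : ℝ}
    (hu : ∀ x, HasDerivAt u (u' x) x) (hu' : ∀ x, HasDerivAt u' (u'' x) x)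
    (hlim : Tendsto u atTop (𝓝 0)) (hε : 0 ≤ ε) (hm : ∀ x, R < x → |u x - u'' x| ≤ ε)
    (hR : |u R| ≤ B) : ∀ x, R ≤ x → |u x| ≤ ε + B * Real.exp (R - x) := by
  have hB : 0 ≤ B := (abs_nonneg _).trans hR
  -- The barrier `ε + B exp (R - x)` minus its second derivative is `ε`, so where `σ u` exceeds it
  -- the difference is strictly convex. The sign `σ` covers both bounds.
  have main : ∀ σ : ℝ, σ = 1 ∨ σ = -1 → ∀ x, R ≤ x → σ * u x - (ε + B * Real.exp (R - x)) ≤ 0 := by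
    intro σ hσ
    have hexp : ∀ x, HasDerivAt (fun x => B * Real.exp (R - x)) (-(B * Real.exp (R - x))) x := by
      intro x
      convert! (((hasDerivAt_id x).const_sub R).exp).const_mul B using 1
      simp
    refine nonpos_of_deriv_pos_of_pos (f' := fun x => σ * u' x - -(B * Real.exp (R - x)))
      (f'' := fun x => σ * u'' x - B * Real.exp (R - x))
      (fun x => ((hu x).const_mul σ).sub ((hexp x).const_add ε))
      (fun x => ((hu' x).const_mul σ).sub (by simpa using (hexp x).fun_neg)) ?_ ?_ ?_
    · intro x hx hpos
      have := abs_le.1 (hm x hx)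
      rcases hσ with rfl | rfl <;> linarith
    · have := abs_le.1 hR
      simp only [sub_self, Real.exp_zero, mul_one]
      rcases hσ with rfl | rfl <;> linarith
    · intro η hη
      have : Tendsto (fun x => σ * u x) atTop (𝓝 0) := by simpa using hlim.const_mul σ
      filter_upwards [this.eventually_lt_const hη] with x hx
      have := mul_nonneg hB (Real.exp_pos (R - x)).le
      linarith
  intro x hx
  have h1 := main 1 (Or.inl rfl) x hx
  have h2 := main (-1) (Or.inr rfl) x hx
  rw [abs_le]
  constructor <;> linarith

/-- A one-dimensional Sobolev bound on a unit interval. -/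
theorem abs_le_integral_unit {f f' : ℝ → ℝ} (hf : ∀ x, HasDerivAt f (f' x) x)
    (hc : Continuous f') (x : ℝ) : |f x| ≤ ∫ y in x..x + 1, (|f y| + |f' y|) := by
  have hcf : Continuous f := continuous_iff_continuousAt.2 fun x => (hf x).continuousAt
  -- The integrand is the derivative of `(y - x - 1) f y`; this weight vanishes at the right end and
  -- is `-1` at the left end.
  have key : ∫ y in x..x + 1, (f y + (y - x - 1) * f' y) = f x := by
    rw [intervalIntegral.integral_eq_sub_of_hasDerivAt (f := fun y => (y - x - 1) * f y)]
    · ring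
    · intro y _
      convert! (((hasDerivAt_id y).sub_const x).sub_const 1).mul (hf y) using 1
      simp
    · exact Continuous.intervalIntegrable (by fun_prop) _ _
  rw [← key]
  refine (intervalIntegral.abs_integral_le_integral_abs (by linarith)).trans ?_
  refine intervalIntegral.integral_mono_on (by linarith)
    (Continuous.intervalIntegrable (by fun_prop) _ _)
    (Continuous.intervalIntegrable (by fun_prop) _ _) fun y hy => ?_
  refine (abs_add_le _ _).trans (add_le_add le_rfl ?_)
  rw [abs_mul]
  refine mul_le_of_le_one_left (abs_nonneg _) (abs_le.2 ?_)
  constructor <;> linarith [hy.1, hy.2]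

/-- A pointwise bound from a bound on a weighted integral of the function and its derivative. -/
theorem mul_abs_le_of_lintegral_le {f f' F : ℝ → ℝ} {C : NNReal} {w x : ℝ}
    (hf : ∀ x, HasDerivAt f (f' x) x) (hc : Continuous f')
    (hF : ∫⁻ y, ENNReal.ofReal (F y) ≤ C)
    (hw : 0 ≤ w) (hle : ∀ y ∈ Ioo x (x + 1), w * (|f y| + |f' y|) ≤ F y) :
    w * |f x| ≤ C := by
  have hcf : Continuous f := continuous_iff_continuousAt.2 fun x => (hf x).continuousAt
  have h1 : w * |f x| ≤ ∫ y in Ioo x (x + 1), w * (|f y| + |f' y|) := by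
    rw [← integral_Ioc_eq_integral_Ioo, ← intervalIntegral.integral_of_le (by linarith),
      intervalIntegral.integral_const_mul]
    exact mul_le_mul_of_nonneg_left (abs_le_integral_unit hf hc x) hw
  refine h1.trans ?_
  rw [integral_eq_lintegral_of_nonneg_ae (ae_of_all _ fun y => by positivity)
    (by fun_prop)]
  refine ENNReal.toReal_le_of_le_ofReal C.coe_nonneg ?_
  rw [ENNReal.ofReal_coe_nnreal]
  refine le_trans ?_ hF
  refine le_trans (setLIntegral_mono' measurableSet_Ioo fun y hy => ?_)
    (setLIntegral_le_lintegral (Ioo x (x + 1)) _)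
  exact ENNReal.ofReal_le_ofReal (hle y hy)

/-! ### The Lax pair as two first-order systems. -/

noncomputable section

namespace CamassaHolm

/-- The two by two matrix with entries `a, b, c, d` as a real-linear operator on `ℂ × ℂ`. -/
def mat2 (a b c d : ℂ) : ℂ × ℂ →L[ℝ] ℂ × ℂ :=
  a • (ContinuousLinearMap.fst ℝ ℂ ℂ).prod (0 : ℂ × ℂ →L[ℝ] ℂ)
    + b • (ContinuousLinearMap.snd ℝ ℂ ℂ).prod (0 : ℂ × ℂ →L[ℝ] ℂ)
    + c • (0 : ℂ × ℂ →L[ℝ] ℂ).prod (ContinuousLinearMap.fst ℝ ℂ ℂ)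
    + d • (0 : ℂ × ℂ →L[ℝ] ℂ).prod (ContinuousLinearMap.snd ℝ ℂ ℂ)

theorem mat2_apply (a b c d : ℂ) (v : ℂ × ℂ) :
    mat2 a b c d v = (a * v.1 + b * v.2, c * v.1 + d * v.2) := by
  simp [mat2]

theorem mat2_smul (a b c d z : ℂ) (v : ℂ × ℂ) : mat2 a b c d (z • v) = z • mat2 a b c d v := by
  simp only [mat2_apply, Prod.smul_mk, Prod.smul_fst, Prod.smul_snd, smul_eq_mul]
  ext <;> simp <;> ring

theorem mat2_sub (a b c d a' b' c' d' : ℂ) :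
    mat2 a b c d - mat2 a' b' c' d' = mat2 (a - a') (b - b') (c - c') (d - d') := by
  simp only [mat2]; module

theorem norm_mat2_le (a b c d : ℂ) : ‖mat2 a b c d‖ ≤ ‖a‖ + ‖b‖ + ‖c‖ + ‖d‖ := by
  refine ContinuousLinearMap.opNorm_le_bound _ (by positivity) fun v => ?_
  have h1 : ‖v.1‖ ≤ ‖v‖ := norm_fst_le v
  have h2 : ‖v.2‖ ≤ ‖v‖ := norm_snd_le v
  rw [mat2_apply, Prod.norm_mk]
  have e1 := norm_add_le (a * v.1) (b * v.2)
  have e2 := norm_add_le (c * v.1) (d * v.2)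
  rw [norm_mul, norm_mul] at e1 e2
  have := mul_le_mul_of_nonneg_left h1 (norm_nonneg a)
  have := mul_le_mul_of_nonneg_left h2 (norm_nonneg b)
  have := mul_le_mul_of_nonneg_left h1 (norm_nonneg c)
  have := mul_le_mul_of_nonneg_left h2 (norm_nonneg d)
  have p1 := mul_nonneg (norm_nonneg a) (norm_nonneg v)
  have p2 := mul_nonneg (norm_nonneg b) (norm_nonneg v)
  have p3 := mul_nonneg (norm_nonneg c) (norm_nonneg v)
  have p4 := mul_nonneg (norm_nonneg d) (norm_nonneg v)
  apply max_le <;> linarith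

theorem hasDerivWithinAt_mat2 {a b c d : ℝ → ℂ} {a' b' c' d' : ℂ} {s : Set ℝ} {x : ℝ}
    (ha : HasDerivWithinAt a a' s x) (hb : HasDerivWithinAt b b' s x)
    (hc : HasDerivWithinAt c c' s x) (hd : HasDerivWithinAt d d' s x) :
    HasDerivWithinAt (fun y => mat2 (a y) (b y) (c y) (d y)) (mat2 a' b' c' d') s x :=
  (((ha.smul_const _).add (hb.smul_const _)).add (hc.smul_const _)).add
    (hd.smul_const ((0 : ℂ × ℂ →L[ℝ] ℂ).prod (ContinuousLinearMap.snd ℝ ℂ ℂ)))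

theorem ContinuousOn.mat2 {X : Type*} [TopologicalSpace X] {a b c d : X → ℂ} {s : Set X}
    (ha : ContinuousOn a s) (hb : ContinuousOn b s) (hc : ContinuousOn c s)
    (hd : ContinuousOn d s) :
    ContinuousOn (fun y => mat2 (a y) (b y) (c y) (d y)) s :=
  (((ha.smul continuousOn_const).add (hb.smul continuousOn_const)).add
    (hc.smul continuousOn_const)).add (hd.smul continuousOn_const)

variable {ω : ℝ} {u : ℝ → ℝ → ℝ}

namespace IsClassicalSolution

theorem hasDerivAt_u (h : IsClassicalSolution ω u) {x t : ℝ} (ht : 0 < t) :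
    HasDerivAt (fun y => u y t) (dx u x t) x :=
  ((h.contDiff_x t ht).differentiable (by norm_num) x).hasDerivAt

theorem contDiff_ux (h : IsClassicalSolution ω u) {t : ℝ} (ht : 0 < t) :
    ContDiff ℝ 2 (fun y => dx u y t) :=
  ((contDiff_succ_iff_deriv (n := 2)).1 (h.contDiff_x t ht)).2.2

theorem hasDerivAt_ux (h : IsClassicalSolution ω u) {x t : ℝ} (ht : 0 < t) :
    HasDerivAt (fun y => dx u y t) (dx (dx u) x t) x :=
  ((h.contDiff_ux ht).differentiable (by norm_num) x).hasDerivAt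

theorem hasDerivAt_uxx (h : IsClassicalSolution ω u) {x t : ℝ} (ht : 0 < t) :
    HasDerivAt (fun y => dx (dx u) y t) (dx (dx (dx u)) x t) x :=
  (((contDiff_succ_iff_deriv (n := 1)).1 (h.contDiff_ux ht)).2.2.differentiable
    (by norm_num) x).hasDerivAt

theorem hasDerivAt_ut (h : IsClassicalSolution ω u) {x t : ℝ} (ht : 0 < t) :
    HasDerivAt (fun y => dt u y t) (dx (dt u) x t) x :=
  ((h.contDiff_t_x t ht).differentiable (by norm_num) x).hasDerivAt

theorem hasDerivAt_utx (h : IsClassicalSolution ω u) {x t : ℝ} (ht : 0 < t) :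
    HasDerivAt (fun y => dx (dt u) y t) (dx (dx (dt u)) x t) x :=
  (((contDiff_succ_iff_deriv (n := 1)).1 (h.contDiff_t_x t ht)).2.2.differentiable
    (by norm_num) x).hasDerivAt

theorem hasDerivAt_momentum_x (h : IsClassicalSolution ω u) {x t : ℝ} (ht : 0 < t) :
    HasDerivAt (fun y => momentum u y t) (dx u x t - dx (dx (dx u)) x t) x :=
  (h.hasDerivAt_u ht).sub (h.hasDerivAt_uxx ht)

theorem hasDerivAt_time_u (h : IsClassicalSolution ω u) {x t : ℝ} (ht : 0 < t) :
    HasDerivAt (u x) (dt u x t) t :=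
  (h.differentiable_t x t ht).hasDerivAt

/-- A classical solution provides `u_t` and its `x`-derivatives; the time derivatives of `u_x` and
`u_xx` come from exchanging the order of differentiation. -/
theorem hasDerivAt_time_ux (h : IsClassicalSolution ω u) {x t : ℝ} (ht : 0 < t) :
    HasDerivAt (dx u x) (dx (dt u) x t) t :=
  hasDerivAt_deriv_comm (fun _ _ hs => h.hasDerivAt_time_u hs) (fun _ _ hs => h.hasDerivAt_u hs)
    (fun _ _ hs => h.hasDerivAt_ut hs) h.cont_utx ht

theorem hasDerivAt_time_uxx (h : IsClassicalSolution ω u) {x t : ℝ} (ht : 0 < t) :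
    HasDerivAt (dx (dx u) x) (dx (dx (dt u)) x t) t :=
  hasDerivAt_deriv_comm (fun _ _ hs => h.hasDerivAt_time_ux hs) (fun _ _ hs => h.hasDerivAt_ux hs)
    (fun _ _ hs => h.hasDerivAt_utx hs) h.cont_utxx ht

/-- The Camassa-Holm equation in terms of the momentum. -/
theorem hasDerivAt_time_momentum (h : IsClassicalSolution ω u) {x t : ℝ} (ht : 0 < t) :
    HasDerivAt (momentum u x) (-2 * dx u x t * (momentum u x t + ω)
      - u x t * (dx u x t - dx (dx (dx u)) x t)) t := by
  convert! (h.hasDerivAt_time_u ht).sub (h.hasDerivAt_time_uxx ht) using 1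
  have := h.equation x t ht
  simp only [momentum]
  linarith

end IsClassicalSolution

/-- The coefficient `r` of the spectral problem in the form `φ'' = r φ`. -/
def potential (ω : ℝ) (u : ℝ → ℝ → ℝ) (lm : ℂ) (x t : ℝ) : ℂ :=
  1 / 4 - lm / ω * ((momentum u x t : ℝ) + ω)

/-- The coefficient of the first-order system in `x` for `(φ, φ_x)`. -/
def laxX (ω : ℝ) (u : ℝ → ℝ → ℝ) (lm : ℂ) (x t : ℝ) : ℂ × ℂ →L[ℝ] ℂ × ℂ :=
  mat2 0 1 (potential ω u lm x t) 0

/-- The coefficient of the first-order system in `t` for `(φ, φ_x)`. -/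
def laxT (ω : ℝ) (u : ℝ → ℝ → ℝ) (lm : ℂ) (x t : ℝ) : ℂ × ℂ →L[ℝ] ℂ × ℂ :=
  mat2 ((dx u x t : ℝ) / 2) (-((ω : ℂ) / (2 * lm) + (u x t : ℝ)))
    (-((ω : ℂ) / (2 * lm) + (u x t : ℝ)) * potential ω u lm x t + (dx (dx u) x t : ℝ) / 2)
    (-((dx u x t : ℝ) / 2))

/-- The `t`-derivative of `laxX` on a solution of the Camassa-Holm equation. -/
def laxXt (ω : ℝ) (u : ℝ → ℝ → ℝ) (lm : ℂ) (x t : ℝ) : ℂ × ℂ →L[ℝ] ℂ × ℂ :=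
  mat2 0 0 (-(lm / ω * ((-2 * dx u x t * (momentum u x t + ω)
      - u x t * (dx u x t - dx (dx (dx u)) x t) : ℝ) : ℂ))) 0

/-- The `x`-derivative of `laxT`. -/
def laxTx (ω : ℝ) (u : ℝ → ℝ → ℝ) (lm : ℂ) (x t : ℝ) : ℂ × ℂ →L[ℝ] ℂ × ℂ :=
  mat2 ((dx (dx u) x t : ℝ) / 2) (-(dx u x t : ℝ))
    (-(dx u x t : ℝ) * potential ω u lm x t
      + -((ω : ℂ) / (2 * lm) + (u x t : ℝ)) * -(lm / ω * ((dx u x t - dx (dx (dx u)) x t : ℝ) : ℂ))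
      + (dx (dx (dx u)) x t : ℝ) / 2)
    (-((dx (dx u) x t : ℝ) / 2))

/-- The first row of `laxT` is the claimed equation, the second its `x`-derivative with `φ_xx = r φ`
inserted. Since `laxXt` already has `m_t` replaced by its value from the Camassa–Holm equation, the
identity is purely algebraic in `u` and its `x`-derivatives. -/
theorem lax_zero_curvature (hω : ω ≠ 0) {lm : ℂ} (hlm : lm ≠ 0) (x t : ℝ) :
    laxTx ω u lm x t + laxT ω u lm x t ∘L laxX ω u lm x t
      = laxXt ω u lm x t + laxX ω u lm x t ∘L laxT ω u lm x t := by
  have hω' : (ω : ℂ) ≠ 0 := by exact_mod_cast hω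
  have H : ∀ v, (laxTx ω u lm x t + laxT ω u lm x t ∘L laxX ω u lm x t) v
      = (laxXt ω u lm x t + laxX ω u lm x t ∘L laxT ω u lm x t) v := by
    rintro ⟨v, w⟩
    simp only [laxTx, laxT, laxX, laxXt, add_apply, ContinuousLinearMap.comp_apply, mat2_apply,
      potential, momentum]
    refine Prod.ext ?_ ?_
    · simp only [Prod.mk_add_mk]; push_cast; ring
    · simp only [Prod.mk_add_mk]; push_cast; field_simp; ring
  exact ContinuousLinearMap.ext H

theorem IsClassicalSolution.hasDerivAt_laxX (h : IsClassicalSolution ω u) (lm : ℂ) {x t : ℝ}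
    (ht : 0 < t) : HasDerivAt (laxX ω u lm x) (laxXt ω u lm x t) t := by
  rw [← hasDerivWithinAt_univ]
  refine hasDerivWithinAt_mat2 (hasDerivWithinAt_const ..) (hasDerivWithinAt_const ..) ?_
    (hasDerivWithinAt_const ..)
  exact (((h.hasDerivAt_time_momentum ht).ofReal_comp.add_const (ω : ℂ)).const_mul
    (lm / ω)).const_sub (1 / 4) |>.hasDerivWithinAt

theorem IsClassicalSolution.hasDerivAt_potential_x (h : IsClassicalSolution ω u) (lm : ℂ)
    {x t : ℝ} (ht : 0 < t) : HasDerivAt (fun y => potential ω u lm y t)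
      (-(lm / ω * ((dx u x t - dx (dx (dx u)) x t : ℝ) : ℂ))) x :=
  ((((h.hasDerivAt_momentum_x ht).ofReal_comp.add_const (ω : ℂ)).const_mul
    (lm / ω)).const_sub (1 / 4))

theorem IsClassicalSolution.hasDerivAt_laxT (h : IsClassicalSolution ω u) (lm : ℂ) {x t : ℝ}
    (ht : 0 < t) : HasDerivAt (fun y => laxT ω u lm y t) (laxTx ω u lm x t) x := by
  rw [← hasDerivWithinAt_univ]
  have hβ : HasDerivAt (fun y => -((ω : ℂ) / (2 * lm) + (u y t : ℝ))) (-(dx u x t : ℝ) : ℂ) x :=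
    ((h.hasDerivAt_u ht).ofReal_comp.const_add _).fun_neg
  have hα : HasDerivAt (fun y => ((dx u y t : ℝ) : ℂ) / 2) ((dx (dx u) x t : ℝ) / 2 : ℂ) x :=
    (h.hasDerivAt_ux ht).ofReal_comp.div_const 2
  refine hasDerivWithinAt_mat2 hα.hasDerivWithinAt hβ.hasDerivWithinAt ?_
    hα.fun_neg.hasDerivWithinAt
  exact ((hβ.mul (h.hasDerivAt_potential_x lm ht)).add
    ((h.hasDerivAt_uxx ht).ofReal_comp.div_const 2)).hasDerivWithinAt

theorem continuousOn_ofReal_prod {f : ℝ → ℝ → ℝ} (hf : ContinuousPosTime f) :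
    ContinuousOn (fun p : ℝ × ℝ => (f p.1 p.2 : ℂ)) {p | 0 < p.2} :=
  Complex.continuous_ofReal.comp_continuousOn hf

theorem IsClassicalSolution.continuousOn_potential (h : IsClassicalSolution ω u) (lm : ℂ) :
    ContinuousOn (fun p : ℝ × ℝ => potential ω u lm p.1 p.2) {p | 0 < p.2} := by
  have : ContinuousOn (fun p : ℝ × ℝ => ((momentum u p.1 p.2 : ℝ) : ℂ)) {p | 0 < p.2} :=
    Complex.continuous_ofReal.comp_continuousOn (h.cont_u.sub h.cont_uxx)
  unfold potential
  fun_prop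

theorem IsClassicalSolution.continuousOn_laxT (h : IsClassicalSolution ω u) (lm : ℂ) :
    ContinuousOn (fun p : ℝ × ℝ => laxT ω u lm p.1 p.2) {p | 0 < p.2} := by
  have hr := h.continuousOn_potential lm
  have h0 := continuousOn_ofReal_prod h.cont_u
  have h1 := continuousOn_ofReal_prod h.cont_ux
  have h2 := continuousOn_ofReal_prod h.cont_uxx
  refine ContinuousOn.mat2 ?_ ?_ ?_ ?_ <;> fun_prop

theorem IsClassicalSolution.continuousOn_laxTx (h : IsClassicalSolution ω u) (lm : ℂ) :
    ContinuousOn (fun p : ℝ × ℝ => laxTx ω u lm p.1 p.2) {p | 0 < p.2} := by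
  have hr := h.continuousOn_potential lm
  have h0 := continuousOn_ofReal_prod h.cont_u
  have h1 := continuousOn_ofReal_prod h.cont_ux
  have h2 := continuousOn_ofReal_prod h.cont_uxx
  have h3 := continuousOn_ofReal_prod h.cont_uxxx
  refine ContinuousOn.mat2 ?_ ?_ ?_ ?_
  all_goals push_cast; fun_prop

/-! ### Behavior of the Lax pair at infinity. -/

/-- `f(x, t)` tends to `d` as `x` tends along `l`, uniformly for `t ∈ [a, b]`. -/
def TendstoUnif (f : ℝ → ℝ → ℝ) (d : ℝ) (l : Filter ℝ) (a b : ℝ) : Prop :=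
  ∀ ε > 0, ∀ᶠ x in l, ∀ t ∈ Icc a b, |f x t - d| ≤ ε

/-- `f(x, t)` is bounded for `x ∈ ℝ` and `t ∈ [a, b]`. -/
def BoundedUnif (f : ℝ → ℝ → ℝ) (a b : ℝ) : Prop :=
  ∃ B, ∀ x, ∀ t ∈ Icc a b, |f x t| ≤ B

theorem TendstoUnif.tendsto {f : ℝ → ℝ → ℝ} {d a b t : ℝ} {l : Filter ℝ}
    (h : TendstoUnif f d l a b) (ht : t ∈ Icc a b) : Tendsto (fun x => f x t) l (𝓝 d) := by
  rw [Metric.tendsto_nhds]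
  intro ε hε
  filter_upwards [h (ε / 2) (by positivity)] with x hx
  rw [Real.dist_eq]
  linarith [hx t ht]

/-- The behavior of `u` at infinity that the evolution of Jost solutions needs, on `[a, b]`. -/
structure AsymptoticTo (u : ℝ → ℝ → ℝ) (d : ℝ) (l : Filter ℝ) (a b : ℝ) : Prop where
  u_lim : TendstoUnif u d l a b
  ux_lim : TendstoUnif (dx u) 0 l a b
  uxx_lim : TendstoUnif (dx (dx u)) 0 l a b
  u_bdd : BoundedUnif u a b
  ux_bdd : BoundedUnif (dx u) a b
  uxx_bdd : BoundedUnif (dx (dx u)) a b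

theorem exists_potential_bound (lm : ℂ) {a b : ℝ} (h0 : BoundedUnif u a b)
    (h2 : BoundedUnif (dx (dx u)) a b) :
    ∃ K : NNReal, ∀ x, ∀ t ∈ Icc a b, ‖potential ω u lm x t‖ ≤ K := by
  obtain ⟨B₀, hB₀⟩ := h0
  obtain ⟨B₂, hB₂⟩ := h2
  refine ⟨(1 + ‖lm / ω‖ * (B₀ + B₂ + |ω|)).toNNReal, fun x t ht => ?_⟩
  refine le_trans ?_ (Real.le_coe_toNNReal _)
  unfold potential
  refine (norm_sub_le _ _).trans (add_le_add (by norm_num) ?_)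
  rw [norm_mul]
  gcongr
  rw [← Complex.ofReal_add, Complex.norm_real, Real.norm_eq_abs]
  refine (abs_add_le _ _).trans (add_le_add ?_ le_rfl)
  exact (abs_sub _ _).trans (add_le_add (hB₀ x t ht) (hB₂ x t ht))

theorem exists_laxT_bound (lm : ℂ) {a b : ℝ} (h0 : BoundedUnif u a b)
    (h1 : BoundedUnif (dx u) a b) (h2 : BoundedUnif (dx (dx u)) a b) :
    ∃ M : ℝ, ∀ x, ∀ t ∈ Icc a b, ‖laxT ω u lm x t‖ ≤ M := by
  obtain ⟨K, hK⟩ := exists_potential_bound (ω := ω) lm h0 h2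
  obtain ⟨B₀, hB₀⟩ := h0
  obtain ⟨B₁, hB₁⟩ := h1
  obtain ⟨B₂, hB₂⟩ := h2
  refine ⟨B₁ / 2 + (‖(ω : ℂ) / (2 * lm)‖ + B₀) + ((‖(ω : ℂ) / (2 * lm)‖ + B₀) * K + B₂ / 2)
    + B₁ / 2, fun x t ht => (norm_mat2_le _ _ _ _).trans ?_⟩
  have e1 : ‖((dx u x t : ℝ) : ℂ) / 2‖ ≤ B₁ / 2 := by
    rw [norm_div, Complex.norm_real, Complex.norm_ofNat]
    gcongr; exact hB₁ x t ht
  have e2 : ‖((dx (dx u) x t : ℝ) : ℂ) / 2‖ ≤ B₂ / 2 := by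
    rw [norm_div, Complex.norm_real, Complex.norm_ofNat]
    gcongr; exact hB₂ x t ht
  have e3 : ‖-((ω : ℂ) / (2 * lm) + (u x t : ℝ))‖ ≤ ‖(ω : ℂ) / (2 * lm)‖ + B₀ := by
    rw [norm_neg]
    refine (norm_add_le _ _).trans ?_
    rw [Complex.norm_real]
    gcongr; exact hB₀ x t ht
  have e4 := (norm_add_le (-((ω : ℂ) / (2 * lm) + (u x t : ℝ)) * potential ω u lm x t)
    ((dx (dx u) x t : ℝ) / 2 : ℂ))
  rw [norm_mul] at e4
  have e5 := mul_le_mul e3 (hK x t ht) (norm_nonneg _) ((norm_nonneg _).trans e3)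
  rw [norm_neg ((dx u x t : ℂ) / 2)]
  linarith

/-- The limit of `laxT` at a point at infinity where `u` tends to `d`. -/
def laxTLimit (ω d : ℝ) (lm κ : ℂ) : ℂ × ℂ →L[ℝ] ℂ × ℂ :=
  mat2 0 (-((ω : ℂ) / (2 * lm) + d)) (-((ω : ℂ) / (2 * lm) + d) * -κ ^ 2) 0

/-- The number `κ` is the wave number of the limit equation: `m → d` gives `r → -κ²`. The error is a
combination of `u - d`, `u_x` and `u_xx` with bounded coefficients, which `C` collects. -/
theorem laxT_sub_laxTLimit_le {lm κ : ℂ} {d : ℝ} (hκ : κ ^ 2 = lm / ω * (d + ω) - 1 / 4)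
    {l : Filter ℝ} {a b : ℝ} (h : AsymptoticTo u d l a b) :
    ∀ ε > 0, ∀ᶠ x in l, ∀ t ∈ Icc a b, ‖laxT ω u lm x t - laxTLimit ω d lm κ‖ ≤ ε := by
  intro ε hε
  obtain ⟨K, hK⟩ := exists_potential_bound (ω := ω) lm h.u_bdd h.uxx_bdd
  set P := ‖(ω : ℂ) / (2 * lm) + d‖
  set Q := ‖lm / ω‖
  set C := 3 + K + 2 * P * Q with hC
  have hC0 : 0 < C := by positivity
  set η := ε / C with hη
  have hη0 : 0 < η := by positivity
  filter_upwards [h.u_lim η hη0, h.ux_lim η hη0, h.uxx_lim η hη0] with x h0 h1 h2 t ht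
  replace h0 := h0 t ht
  replace h1 := h1 t ht
  replace h2 := h2 t ht
  rw [sub_zero] at h1 h2
  have n1 : ‖((dx u x t : ℝ) : ℂ)‖ ≤ η := by rw [Complex.norm_real]; exact h1
  have n2 : ‖((dx (dx u) x t : ℝ) : ℂ)‖ ≤ η := by rw [Complex.norm_real]; exact h2
  have n0 : ‖((u x t - d : ℝ) : ℂ)‖ ≤ η := by rw [Complex.norm_real]; exact h0
  have nm : ‖((u x t - d - dx (dx u) x t : ℝ) : ℂ)‖ ≤ 2 * η := by
    rw [Complex.norm_real, Real.norm_eq_abs]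
    have := abs_sub (u x t - d) (dx (dx u) x t)
    linarith
  rw [laxT, laxTLimit, mat2_sub]
  refine (norm_mat2_le _ _ _ _).trans ?_
  have e2 : -((ω : ℂ) / (2 * lm) + (u x t : ℝ)) - -((ω : ℂ) / (2 * lm) + d)
      = -((u x t - d : ℝ) : ℂ) := by push_cast; ring
  have e3 : -((ω : ℂ) / (2 * lm) + (u x t : ℝ)) * potential ω u lm x t + (dx (dx u) x t : ℝ) / 2
      - -((ω : ℂ) / (2 * lm) + d) * -κ ^ 2
      = -(((u x t - d : ℝ) : ℂ) * potential ω u lm x t)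
        + ((ω : ℂ) / (2 * lm) + d) * (lm / ω * ((u x t - d - dx (dx u) x t : ℝ) : ℂ))
        + ((dx (dx u) x t : ℝ) : ℂ) / 2 := by
    rw [hκ]; simp only [potential, momentum]; push_cast; ring
  rw [e2, e3, sub_zero, sub_zero, norm_neg, norm_neg, norm_div, Complex.norm_ofNat]
  have b3 := norm_add₃_le (a := -(((u x t - d : ℝ) : ℂ) * potential ω u lm x t))
    (b := ((ω : ℂ) / (2 * lm) + d) * (lm / ω * ((u x t - d - dx (dx u) x t : ℝ) : ℂ)))
    (c := ((dx (dx u) x t : ℝ) : ℂ) / 2)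
  rw [norm_neg, norm_mul, norm_mul, norm_mul, norm_div _ (2 : ℂ), Complex.norm_ofNat] at b3
  have b4 := mul_le_mul n0 (hK x t ht) (norm_nonneg _) hη0.le
  have b5 : P * (Q * ‖((u x t - d - dx (dx u) x t : ℝ) : ℂ)‖) ≤ P * (Q * (2 * η)) := by
    gcongr
  have : C * η = ε := by rw [hη]; field_simp
  have : C * η = 3 * η + η * K + P * (Q * (2 * η)) := by rw [hC]; ring
  linarith

/-- The vector `(1, iκ)`, formed by the plane wave and its derivative, is an eigenvector of
`laxTLimit` with eigenvalue `-iκ (d + ω / (2λ))`. -/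
theorem hasDerivAt_limit_solution (d : ℝ) (lm κ A : ℂ) (t : ℝ) :
    HasDerivAt (fun s : ℝ => (A * Complex.exp (-Complex.I * κ * (d + ω / (2 * lm)) * s),
        Complex.I * κ * (A * Complex.exp (-Complex.I * κ * (d + ω / (2 * lm)) * s))))
      (laxTLimit ω d lm κ (A * Complex.exp (-Complex.I * κ * (d + ω / (2 * lm)) * t),
        Complex.I * κ * (A * Complex.exp (-Complex.I * κ * (d + ω / (2 * lm)) * t)))) t := by
  have h1 : HasDerivAt (fun s : ℝ => A * Complex.exp (-Complex.I * κ * (d + ω / (2 * lm)) * s))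
      (-Complex.I * κ * (d + ω / (2 * lm))
        * (A * Complex.exp (-Complex.I * κ * (d + ω / (2 * lm)) * t))) t := by
    have := (((hasDerivAt_id t).ofReal_comp.const_mul
      (-Complex.I * κ * (d + ω / (2 * lm)))).cexp).const_mul A
    convert! this using 1
    simp; ring
  convert! h1.prodMk (h1.const_mul (Complex.I * κ)) using 1
  rw [laxTLimit, mat2_apply]
  refine Prod.ext ?_ ?_
  · simp only; ring
  · simp only
    linear_combination ((d + ω / (2 * lm)) * κ ^ 2
      * (A * Complex.exp (-Complex.I * κ * (d + ω / (2 * lm)) * t))) * Complex.I_sq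

theorem hasDerivAt_fst_snd {f : ℝ → ℂ × ℂ} {v : ℂ × ℂ} {x : ℝ} (hf : HasDerivAt f v x) :
    HasDerivAt (fun y => (f y).1) v.1 x ∧ HasDerivAt (fun y => (f y).2) v.2 x :=
  ⟨(ContinuousLinearMap.fst ℝ ℂ ℂ).hasFDerivAt.comp_hasDerivAt x hf,
    (ContinuousLinearMap.snd ℝ ℂ ℂ).hasFDerivAt.comp_hasDerivAt x hf⟩

/-- The spectral problem as a first-order system. -/
theorem SolvesXEquation.hasDerivAt {lm : ℂ} {t : ℝ} {f : ℝ → ℂ} (hω : ω ≠ 0)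
    (hm : ∀ x, momentum u x t + ω ≠ 0) (hf : SolvesXEquation ω u lm t f) (x : ℝ) :
    HasDerivAt f (deriv f x) x ∧ HasDerivAt (deriv f) (potential ω u lm x t * f x) x := by
  refine ⟨(hf.1 x).hasDerivAt, ?_⟩
  convert! (hf.2.1 x).hasDerivAt using 1
  have h := hf.2.2 x
  have hω' : (ω : ℂ) ≠ 0 := by exact_mod_cast hω
  have hm' : ((momentum u x t : ℝ) : ℂ) + ω ≠ 0 := by exact_mod_cast hm x
  push_cast at h
  rw [potential]
  field_simp at h ⊢
  linear_combination h

/-- The limit of a rescaled Jost solution determines the limit of its derivative. -/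
theorem tendsto_exp_mul_deriv {lm κ L : ℂ} {d t : ℝ} {φ φ' : ℝ → ℂ} {l : Filter ℝ}
    (hl : l.UnitStable) (hκ : κ ^ 2 = lm / ω * (d + ω) - 1 / 4)
    (hm : Tendsto (fun x => momentum u x t) l (𝓝 d))
    (hφ : ∀ x, HasDerivAt φ (φ' x) x)
    (hφ' : ∀ x, HasDerivAt φ' (potential ω u lm x t * φ x) x)
    (hlim : Tendsto (fun x : ℝ => Complex.exp (-Complex.I * κ * x) * φ x) l (𝓝 L)) :
    Tendsto (fun x : ℝ => Complex.exp (-Complex.I * κ * x) * φ' x) l (𝓝 (Complex.I * κ * L)) := by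
  have he : ∀ x : ℝ, HasDerivAt (fun x : ℝ => Complex.exp (-Complex.I * κ * x))
      (Complex.exp (-Complex.I * κ * x) * (-Complex.I * κ)) x := by
    intro x
    simpa using ((hasDerivAt_id x).ofReal_comp.const_mul (-Complex.I * κ)).cexp
  have hy : ∀ x : ℝ, HasDerivAt (fun x : ℝ => Complex.exp (-Complex.I * κ * x) * φ x)
      (Complex.exp (-Complex.I * κ * x) * (φ' x - Complex.I * κ * φ x)) x := by
    intro x
    convert! (he x).mul (hφ x) using 1
    ring
  have hy' : ∀ x : ℝ, HasDerivAt
      (fun x : ℝ => Complex.exp (-Complex.I * κ * x) * (φ' x - Complex.I * κ * φ x))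
      (Complex.exp (-Complex.I * κ * x) * (potential ω u lm x t * φ x - 2 * Complex.I * κ * φ' x
        - κ ^ 2 * φ x)) x := by
    intro x
    convert! (he x).mul ((hφ' x).fun_sub ((hφ x).const_mul (Complex.I * κ))) using 1
    linear_combination (-κ ^ 2 * φ x * Complex.exp (-Complex.I * κ * x)) * Complex.I_sq
  -- For `y = exp (-iκx) φ` one has `y'' + 2iκ y' = (r + κ²) y`, and `r + κ² = -(λ/ω)(m - d)` tends
  -- to zero.
  have h0 := tendsto_deriv_zero_of_tendsto hl (κ := 2 * Complex.I * κ) hy hy' hlim (by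
    have h1 : Tendsto (fun x => -(lm / ω) * ((momentum u x t - d : ℝ) : ℂ)) l (𝓝 0) := by
      have := (Complex.continuous_ofReal.tendsto _).comp (hm.sub_const d)
      simpa using this.const_mul (-(lm / (ω : ℂ)))
    have h2 := h1.mul hlim
    rw [zero_mul] at h2
    refine h2.congr fun x => ?_
    rw [potential]
    push_cast
    linear_combination (2 * κ ^ 2 * φ x * Complex.exp (-Complex.I * κ * x)) * Complex.I_sq
      - (φ x * Complex.exp (-Complex.I * κ * x)) * hκ)
  have h3 := h0.add (hlim.const_mul (Complex.I * κ))
  rw [zero_add] at h3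
  refine h3.congr fun x => ?_
  ring

/-! ### Identification of the Jost solution with the flow. -/

/-- The evolution of Jost solutions, normalized along a filter at infinity along which `u` tends
to `d`. -/
theorem solvesTEquation_of_jost (hω : ω ≠ 0) (h : IsClassicalSolution ω u)
    (hm : ∀ x t, 0 < t → momentum u x t + ω ≠ 0) {lm κ A : ℂ} (hlm : lm ≠ 0) (hA : A ≠ 0) {d : ℝ}
    (hκ : κ ^ 2 = lm / ω * (d + ω) - 1 / 4) {l : Filter ℝ} [l.NeBot] (hl : l.UnitStable)
    (hexp : ∀ᶠ x : ℝ in l, 1 ≤ ‖Complex.exp (-Complex.I * κ * x)‖)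
    (hasym : ∀ a b, 0 < a → a ≤ b → AsymptoticTo u d l a b)
    {φ : ℝ → ℝ → ℂ} (hφ : ∀ t, 0 < t → SolvesXEquation ω u lm t (fun x => φ x t))
    (hlim : ∀ t, 0 < t → Tendsto (fun x : ℝ => Complex.exp (-Complex.I * κ * x) * φ x t) l
      (𝓝 (A * Complex.exp (-Complex.I * κ * (d + ω / (2 * lm)) * t)))) :
    SolvesTEquation ω u lm φ := by
  intro x₀ t₀ ht₀
  have has := hasym (t₀ / 2) (2 * t₀) (by positivity) (by linarith)
  obtain ⟨M, hM⟩ := exists_laxT_bound (ω := ω) lm has.u_bdd has.ux_bdd has.uxx_bdd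
  obtain ⟨K, hK⟩ := exists_potential_bound (ω := ω) lm has.u_bdd has.uxx_bdd
  have hM0 : 0 ≤ M := (norm_nonneg _).trans (hM 0 t₀ ⟨by linarith, by linarith⟩)
  -- The bound `M` is taken on a fixed larger interval, so it does not depend on `δ`; the choice
  -- keeps times positive and meets the smallness condition of `exists_linear_flow`.
  set δ := min (t₀ / 2) (1 / (4 * (M + 1))) with hδ
  have hδ0 : 0 < δ := lt_min (by positivity) (by positivity)
  have hδ1 : δ ≤ t₀ / 2 := min_le_left _ _
  have hδ2 : M * (2 * δ) ≤ 1 / 2 := by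
    have h1 : δ ≤ 1 / (4 * (M + 1)) := min_le_right _ _
    rw [le_div_iff₀ (by positivity)] at h1
    nlinarith
  set a := t₀ - δ with ha
  set b := t₀ + δ with hb
  have hsub : ∀ t ∈ Icc a b, t ∈ Icc (t₀ / 2) (2 * t₀) := fun t ht =>
    ⟨by linarith [ht.1], by linarith [ht.2]⟩
  have hpos : ∀ t ∈ Icc a b, 0 < t := fun t ht => by linarith [(hsub t ht).1]
  have hab : a ≤ b := by linarith
  have haI : a ∈ Icc a b := ⟨le_rfl, hab⟩
  have hmapsTo : ∀ x : ℝ, MapsTo (fun s : ℝ => (x, s)) (Icc a b) {p : ℝ × ℝ | 0 < p.2} :=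
    fun x s hs => hpos s hs
  have hflow := fun x : ℝ => exists_linear_flow (A := laxT ω u lm x) hab
    ((h.continuousOn_laxT lm).comp (f := fun s => (x, s)) (by fun_prop) (hmapsTo x))
    (fun t ht => hM x t (hsub t ht)) (by rw [ha, hb]; linarith)
    (φ x a, deriv (fun y => φ y a) x)
  choose Φ hΦa hΦ using hflow
  have hφd := fun x t (ht : 0 < t) =>
    (hφ t ht).hasDerivAt hω (fun x => hm x t ht) x
  have hΦx := hasDerivAt_of_zero_curvature (U := laxX ω u lm) (V := laxT ω u lm)
    (Ut := laxXt ω u lm) (Vx := laxTx ω u lm) (a := a) (b := b)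
    (fun y t ht => h.hasDerivAt_laxT lm (hpos t ht))
    ((h.continuousOn_laxTx lm).mono fun p hp => hpos p.2 hp.2)
    (fun y t ht => (h.hasDerivAt_laxX lm (hpos t ht)).hasDerivWithinAt)
    (fun y t _ => lax_zero_curvature hω hlm y t)
    (fun y t ht => hM y t (hsub t ht)) hΦ (fun y => by
      simp only [hΦa, laxX, mat2_apply]
      convert! (hφd y a (hpos a haI)).1.prodMk (hφd y a (hpos a haI)).2 using 1
      ext <;> simp)
  have hlim' : ∀ t, t ∈ Icc a b →
      Tendsto (fun x : ℝ => Complex.exp (-Complex.I * κ * x) * deriv (fun y => φ y t) x) l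
        (𝓝 (Complex.I * κ * (A * Complex.exp (-Complex.I * κ * (d + ω / (2 * lm)) * t)))) := by
    intro t ht
    refine tendsto_exp_mul_deriv hl hκ ?_ (fun x => (hφd x t (hpos t ht)).1)
      (fun x => (hφd x t (hpos t ht)).2) (hlim t (hpos t ht))
    have := (has.u_lim.tendsto (hsub t ht)).sub (has.uxx_lim.tendsto (hsub t ht))
    rwa [sub_zero] at this
  have hΦlim : ∀ t ∈ Icc a b, Tendsto (fun x : ℝ => Complex.exp (-Complex.I * κ * x) • Φ x t) l
      (𝓝 (A * Complex.exp (-Complex.I * κ * (d + ω / (2 * lm)) * t),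
        Complex.I * κ * (A * Complex.exp (-Complex.I * κ * (d + ω / (2 * lm)) * t)))) := by
    intro t ht
    refine tendsto_smul_flow (fun y t z v => mat2_smul _ _ _ _ z v)
      (fun y t ht => hM y t (hsub t ht))
      (fun ε hε => (laxT_sub_laxTLimit_le hκ has ε hε).mono fun x hx t ht => hx t (hsub t ht)) hΦ
      (W := fun s : ℝ => (A * Complex.exp (-Complex.I * κ * (d + ω / (2 * lm)) * s),
        Complex.I * κ * (A * Complex.exp (-Complex.I * κ * (d + ω / (2 * lm)) * s))))
      (fun t _ => (hasDerivAt_limit_solution d lm κ A t).hasDerivWithinAt) ?_ ht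
    simp only [hΦa]
    exact (hlim a (hpos a haI)).prodMk_nhds (hlim' a haI)
  have hΦ1 : ∀ t ∈ Icc a b, ∀ x, HasDerivAt (fun y => (Φ y t).1) (Φ x t).2 x := fun t ht x => by
    simpa [laxX, mat2_apply] using (hasDerivAt_fst_snd (hΦx x t ht)).1
  have hΦ2 : ∀ t ∈ Icc a b, ∀ x, HasDerivAt (fun y => (Φ y t).2)
      (potential ω u lm x t * (Φ x t).1) x := fun t ht x => by
    simpa [laxX, mat2_apply] using (hasDerivAt_fst_snd (hΦx x t ht)).2
  -- Both are solutions with the same asymptotics; the uniqueness lemma is applied to their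
  -- difference, with `φ` itself as the reference solution.
  have heq : ∀ t ∈ Icc a b, ∀ x, φ x t = (Φ x t).1 := by
    intro t ht x
    rw [← sub_eq_zero]
    refine eq_zero_of_tendsto_zero (l := l) (r := fun x => potential ω u lm x t) (K := K)
      (fun x => hK x t (hsub t ht)) (f := fun x => φ x t) (f' := deriv fun x => φ x t)
      (h := fun x => φ x t - (Φ x t).1) (h' := fun x => deriv (fun x => φ x t) x - (Φ x t).2)
      (e := fun x => Complex.exp (-Complex.I * κ * x))
      (fun x => (hφd x t (hpos t ht)).1) (fun x => (hφd x t (hpos t ht)).2)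
      (fun x => (hφd x t (hpos t ht)).1.sub (hΦ1 t ht x))
      (fun x => ?_) hexp (mul_ne_zero hA (Complex.exp_ne_zero _)) (hlim t (hpos t ht)) (hlim' t ht)
      ?_ ?_ x
    · rw [mul_sub]
      exact (hφd x t (hpos t ht)).2.sub (hΦ2 t ht x)
    · have := (hlim t (hpos t ht)).sub (hΦlim t ht).fst_nhds
      rw [sub_self] at this
      exact this.congr fun x => by simp [mul_sub]
    · have := (hlim' t ht).sub (hΦlim t ht).snd_nhds
      rw [sub_self] at this
      exact this.congr fun x => by simp [mul_sub]
  have ht₀I : t₀ ∈ Icc a b := ⟨by linarith, by linarith⟩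
  have hnhds : Icc a b ∈ 𝓝 t₀ := Icc_mem_nhds (by linarith) (by linarith)
  have hder := (hasDerivAt_fst_snd ((hΦ x₀ t₀ ht₀I).hasDerivAt hnhds)).1
  have hd2 : deriv (fun y => φ y t₀) x₀ = (Φ x₀ t₀).2 := by
    have : (fun y => φ y t₀) = fun y => (Φ y t₀).1 := funext fun y => heq t₀ ht₀I y
    rw [this]
    exact (hΦ1 t₀ ht₀I x₀).deriv
  rw [hd2, heq t₀ ht₀I x₀]
  refine HasDerivAt.congr_of_eventuallyEq (f := fun s => (Φ x₀ s).1) ?_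
    (by filter_upwards [hnhds] with s hs using heq s hs x₀)
  convert! hder using 1
  rw [laxT, mat2_apply]
  ring

/-! ### Uniform asymptotics of step-like solutions. -/

variable {c : ℝ} {l : ℕ}

theorem IsStepLike.contDiff_momentum (h : IsStepLike c l u) {t : ℝ} (ht : 0 ≤ t) :
    ContDiff ℝ 2 (fun x => momentum u x t) := by
  have h4 := h.contDiff_x t ht
  have h3 : ContDiff ℝ 3 (fun y => dx u y t) := ((contDiff_succ_iff_deriv (n := 3)).1 h4).2.2
  have h2 : ContDiff ℝ 2 (fun y => dx (dx u) y t) := ((contDiff_succ_iff_deriv (n := 2)).1 h3).2.2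
  exact (h4.of_le (by norm_num)).sub h2

/-- The momentum tends to its limits at a rate that is uniform in time. -/
theorem IsStepLike.momentum_decay (h : IsStepLike c l u) {T : ℝ} (hT : 0 ≤ T) :
    ∃ C : NNReal, ∀ t ∈ Icc 0 T, (∀ x, 0 < x → (1 + x) * |momentum u x t| ≤ C) ∧
      ∀ x, x < -1 → -x * |momentum u x t - c| ≤ C := by
  obtain ⟨C, hC⟩ := h.moment_bound T hT
  refine ⟨C, fun t ht => ?_⟩
  have hm := h.contDiff_momentum ht.1
  have hd : ∀ x, HasDerivAt (fun y => momentum u y t) (dx (momentum u) x t) x := fun x =>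
    (hm.differentiable (by norm_num) x).hasDerivAt
  have hc : Continuous fun x => dx (momentum u) x t := hm.continuous_deriv (by norm_num)
  -- Only the first power of the weight and the terms with `m` and `m_x` are needed.
  have key : ∀ w m₀ y : ℝ, 0 ≤ w → w ≤ 1 + |y| → c * heaviside (-y) = m₀ →
      w * (|momentum u y t - m₀| + |dx (momentum u) y t|) ≤ (1 + |y|) ^ (l + 1) *
      (|momentum u y t - c * heaviside (-y)| + |dx (momentum u) y t|
        + |dx (dx (momentum u)) y t|) := by
    rintro w m₀ y hw hwy rfl
    refine mul_le_mul ?_ (by linarith [abs_nonneg (dx (dx (momentum u)) y t)]) (by positivity)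
      (by positivity)
    exact hwy.trans (le_self_pow₀ (by linarith [abs_nonneg y]) (by simp))
  constructor
  · intro x hx
    refine mul_abs_le_of_lintegral_le (f := fun y => momentum u y t) hd hc (hC t ht)
      (by linarith) fun y hy => ?_
    have hy0 : 0 < y := hx.trans hy.1
    have := key (1 + x) 0 y (by linarith) (by rw [abs_of_pos hy0]; linarith [hy.1])
      (by rw [heaviside, if_neg (by linarith), mul_zero])
    rwa [sub_zero] at this
  -- With `x < -1` the unit interval stays left of the jump, and `-x ≤ 1 + |y|` holds on it.
  · intro x hx
    refine mul_abs_le_of_lintegral_le (f := fun y => momentum u y t - c)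
      (fun y => (hd y).sub_const c) hc
      (hC t ht) (by linarith) fun y hy => ?_
    have hy0 : y < 0 := by linarith [hy.2]
    exact key (-x) c y (by linarith) (by rw [abs_of_neg hy0]; linarith [hy.2])
      (by rw [heaviside, if_pos (by linarith), mul_one])

theorem IsStepLike.tendstoUnif_momentum (h : IsStepLike c l u) {a b : ℝ} (ha : 0 < a)
    (hab : a ≤ b) :
    TendstoUnif (momentum u) 0 atTop a b ∧ TendstoUnif (momentum u) c atBot a b := by
  obtain ⟨C, hC⟩ := h.momentum_decay (ha.le.trans hab)
  constructor
  · intro ε hε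
    filter_upwards [eventually_gt_atTop 0, eventually_ge_atTop (C / ε)] with x hx hxC t ht
    have h1 := (hC t ⟨ha.le.trans ht.1, ht.2⟩).1 x hx
    rw [div_le_iff₀ hε] at hxC
    rw [sub_zero]
    have h2 := abs_nonneg (momentum u x t)
    refine le_of_mul_le_mul_left (a := x) ?_ hx
    linarith
  · intro ε hε
    filter_upwards [eventually_lt_atBot (-1), eventually_le_atBot (-(C / ε))] with x hx hxC t ht
    have h1 := (hC t ⟨ha.le.trans ht.1, ht.2⟩).2 x hx
    have hxC' : C / ε ≤ -x := by linarith
    rw [div_le_iff₀ hε] at hxC'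
    refine le_of_mul_le_mul_left (a := -x) ?_ (by linarith)
    linarith

/-- Uniform decay of `g` from uniform decay of `g - g''`. -/
theorem tendstoUnif_zero_of_sub_deriv {g g' g'' : ℝ → ℝ → ℝ} {a b : ℝ}
    (hg : ∀ x, ∀ t ∈ Icc a b, HasDerivAt (fun y => g y t) (g' x t) x)
    (hg' : ∀ x, ∀ t ∈ Icc a b, HasDerivAt (fun y => g' y t) (g'' x t) x)
    (hlim : ∀ t ∈ Icc a b, Tendsto (fun x => g x t) atTop (𝓝 0))
    (hB : ∀ x, ∃ B, ∀ t ∈ Icc a b, |g x t| ≤ B)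
    (hm : TendstoUnif (fun x t => g x t - g'' x t) 0 atTop a b) :
    TendstoUnif g 0 atTop a b := by
  intro ε hε
  -- Past `R` the maximum principle needs uniform bounds only on `g - g''` and on the value at `R`;
  -- the limit of `g` itself may be merely pointwise in time.
  obtain ⟨R, hR⟩ := eventually_atTop.1 (hm (ε / 2) (by positivity))
  obtain ⟨B, hB⟩ := hB R
  have hexp : Tendsto (fun x => B * Real.exp (R - x)) atTop (𝓝 0) := by
    have := (Real.tendsto_exp_atBot.comp
      (tendsto_atBot_add_const_left atTop R tendsto_neg_atTop_atBot)).const_mul B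
    rw [mul_zero] at this
    exact this
  filter_upwards [eventually_ge_atTop R, hexp.eventually_lt_const (half_pos hε)] with x hx hxe t ht
  rw [sub_zero]
  have := abs_le_add_exp_of_abs_sub_deriv_le (hg · t ht) (hg' · t ht) (hlim t ht)
    (half_pos hε).le (fun y hy => by simpa using hR y hy.le t ht) (hB t ht) x hx
  linarith

theorem ContinuousPosTime.bound_at {f : ℝ → ℝ → ℝ} (hf : ContinuousPosTime f) {a b : ℝ}
    (ha : 0 < a) (x : ℝ) : ∃ B, ∀ t ∈ Icc a b, |f x t| ≤ B :=
  isCompact_Icc.exists_bound_of_continuousOn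
    (hf.comp (f := fun t => (x, t)) (by fun_prop) fun _ ht => ha.trans_le ht.1)

theorem ContinuousPosTime.boundedUnif {f : ℝ → ℝ → ℝ} (hf : ContinuousPosTime f) {a b d e : ℝ}
    (ha : 0 < a) (htop : TendstoUnif f d atTop a b) (hbot : TendstoUnif f e atBot a b) :
    BoundedUnif f a b := by
  obtain ⟨R, hR⟩ := eventually_atTop.1 (htop 1 one_pos)
  obtain ⟨S, hS⟩ := eventually_atBot.1 (hbot 1 one_pos)
  obtain ⟨B, hB⟩ := (isCompact_Icc.prod isCompact_Icc).exists_bound_of_continuousOn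
    (hf.mono fun p (hp : p ∈ Icc S R ×ˢ Icc a b) => ha.trans_le hp.2.1)
  refine ⟨max B (max (1 + |d|) (1 + |e|)), fun x t ht => ?_⟩
  rcases le_total R x with h1 | h1
  · have h2 := hR x h1 t ht
    have h3 := abs_sub_abs_le_abs_sub (f x t) d
    exact le_max_of_le_right (le_max_of_le_left (by linarith))
  · rcases le_total x S with h2 | h2
    · have h4 := hS x h2 t ht
      have h3 := abs_sub_abs_le_abs_sub (f x t) e
      exact le_max_of_le_right (le_max_of_le_right (by linarith))
    · exact le_max_of_le_left (hB (x, t) ⟨⟨h2, h1⟩, ht⟩)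

/-- If `f` tends to a limit and `f_xx` to zero, then `f_x` tends to zero, uniformly in time. -/
theorem tendstoUnif_deriv {f f' f'' : ℝ → ℝ → ℝ} {l : Filter ℝ} (hl : l.UnitStable) {a b d : ℝ}
    (hf : ∀ x, ∀ t ∈ Icc a b, HasDerivAt (fun y => f y t) (f' x t) x)
    (hf' : ∀ x, ∀ t ∈ Icc a b, HasDerivAt (fun y => f' y t) (f'' x t) x)
    (h : TendstoUnif f d l a b) (h'' : TendstoUnif f'' 0 l a b) : TendstoUnif f' 0 l a b := by
  intro ε hε
  filter_upwards [hl _ (h (ε / 4) (by positivity)), hl _ (h'' (ε / 4) (by positivity))]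
    with x h0 h2 t ht
  -- At some `ξ` the slope equals the small increment of `f`, and `f'` varies by at most `ε / 4`
  -- between `x` and `ξ`.
  obtain ⟨ξ, hξ, hξe⟩ := exists_hasDerivAt_eq_slope (fun y => f y t) (fun y => f' y t)
    (by linarith : x < x + 1) (fun y _ => (hf y t ht).continuousAt.continuousWithinAt)
    (fun y _ => hf y t ht)
  have key := (convex_Icc x (x + 1)).norm_image_sub_le_of_norm_hasDerivWithin_le
    (f := fun y => f' y t) (C := ε / 4) (fun y _ => (hf' y t ht).hasDerivWithinAt)
    (fun y hy => by simpa using h2 y hy t ht) (Ioo_subset_Icc_self hξ)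
    (⟨le_rfl, by linarith⟩ : x ∈ Icc x (x + 1))
  rw [add_sub_cancel_left, div_one] at hξe
  have h3 : ‖x - ξ‖ ≤ 1 := by
    rw [Real.norm_eq_abs, abs_le]; constructor <;> linarith [hξ.1, hξ.2]
  have h4 := mul_le_mul_of_nonneg_left h3 (by positivity : 0 ≤ ε / 4)
  have h5 := key.trans h4
  rw [hξe, Real.norm_eq_abs] at h5
  have a1 := abs_le.1 (h0 x ⟨le_rfl, by linarith⟩ t ht)
  have a2 := abs_le.1 (h0 (x + 1) ⟨by linarith, le_rfl⟩ t ht)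
  have a3 := abs_le.1 h5
  rw [sub_zero, abs_le]
  constructor <;> linarith [a1.1, a1.2, a2.1, a2.2, a3.1, a3.2]

theorem TendstoUnif.uxx {d : ℝ} {l : Filter ℝ} {a b : ℝ} (h : TendstoUnif u d l a b)
    (hm : TendstoUnif (momentum u) d l a b) : TendstoUnif (dx (dx u)) 0 l a b := by
  intro ε hε
  filter_upwards [h (ε / 2) (by positivity), hm (ε / 2) (by positivity)] with x h1 h2 t ht
  have e : dx (dx u) x t - 0 = (u x t - d) - (momentum u x t - d) := by simp [momentum]
  rw [e]
  refine (abs_sub _ _).trans ?_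
  linarith [h1 t ht, h2 t ht]

/-- The behavior of a step-like solution at both infinities. -/
theorem IsStepLike.asymptoticTo (h : IsStepLike c l u) (hsol : IsClassicalSolution ω u) {a b : ℝ}
    (ha : 0 < a) (hab : a ≤ b) : AsymptoticTo u 0 atTop a b ∧ AsymptoticTo u c atBot a b := by
  have hpos : ∀ t ∈ Icc a b, 0 < t := fun t ht => ha.trans_le ht.1
  obtain ⟨hmtop, hmbot⟩ := h.tendstoUnif_momentum ha hab
  have hutop : TendstoUnif u 0 atTop a b :=
    tendstoUnif_zero_of_sub_deriv (fun _ t ht => hsol.hasDerivAt_u (hpos t ht))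
      (fun _ t ht => hsol.hasDerivAt_ux (hpos t ht))
      (fun t ht => h.right_limit t (hpos t ht).le) (hsol.cont_u.bound_at ha) hmtop
  -- The left end is reduced to the right one by reflection: for `g = u(-x) - c`, the function `g -
  -- g''` is `m(-x) - c`.
  have hubot : TendstoUnif u c atBot a b := by
    have hneg : ∀ x : ℝ, HasDerivAt (fun y : ℝ => -y) (-1) x := fun x => (hasDerivAt_id x).fun_neg
    have := tendstoUnif_zero_of_sub_deriv (a := a) (b := b) (g := fun x t => u (-x) t - c)
      (g' := fun x t => -dx u (-x) t) (g'' := fun x t => dx (dx u) (-x) t)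
      (fun x t ht => by
        simpa using
          ((hsol.hasDerivAt_u (x := -x) (hpos t ht)).scomp x (hneg x)).sub_const c)
      (fun x t ht => by
        simpa using
          ((hsol.hasDerivAt_ux (x := -x) (hpos t ht)).scomp x (hneg x)).fun_neg)
      (fun t ht => by
        have := ((h.left_limit t (hpos t ht).le).comp tendsto_neg_atTop_atBot).sub_const c
        rw [sub_self] at this
        exact this)
      (fun x => by
        obtain ⟨B, hB⟩ := hsol.cont_u.bound_at (b := b) ha (-x)
        exact ⟨B + |c|, fun t ht => (abs_sub _ _).trans (by linarith [hB t ht])⟩)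
      (fun ε hε => by
        filter_upwards [tendsto_neg_atTop_atBot.eventually (hmbot ε hε)] with x hx t ht
        convert! hx t ht using 2
        simp only [momentum]; ring)
    intro ε hε
    filter_upwards [tendsto_neg_atBot_atTop.eventually (this ε hε)] with x hx t ht
    simpa using hx t ht
  have h2top := hutop.uxx hmtop
  have h2bot := hubot.uxx hmbot
  have h1top := tendstoUnif_deriv unitStable_atTop (fun _ t ht => hsol.hasDerivAt_u (hpos t ht))
    (fun _ t ht => hsol.hasDerivAt_ux (hpos t ht)) hutop h2top
  have h1bot := tendstoUnif_deriv unitStable_atBot (fun _ t ht => hsol.hasDerivAt_u (hpos t ht))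
    (fun _ t ht => hsol.hasDerivAt_ux (hpos t ht)) hubot h2bot
  have b0 := hsol.cont_u.boundedUnif ha hutop hubot
  have b1 := hsol.cont_ux.boundedUnif ha h1top h1bot
  have b2 := hsol.cont_uxx.boundedUnif ha h2top h2bot
  exact ⟨⟨hutop, h1top, h2top, b0, b1, b2⟩, ⟨hubot, h1bot, h2bot, b0, b1, b2⟩⟩

/-! ### The branch `z(k)` and the two Jost solutions. -/

theorem step_ratio_pos (hcω : 0 < c / ω) : 0 < (c + ω) / ω := by
  have hω : ω ≠ 0 := by rintro rfl; simp at hcω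
  rw [add_div, div_self hω]
  positivity

/-- The relation is closed and holds off the cut, so it passes to both boundary values. Of the
branch, only this relation and the sign of `Im z` matter. -/
theorem IsZValue.sq_eq {k z : ℂ} (h : IsZValue ω c k z) :
    z ^ 2 = k ^ 2 + edge ω c := by
  have hclosed : IsClosed {p : ℂ × ℂ | p.2 ^ 2 = p.1 ^ 2 + edge ω c} :=
    isClosed_eq (by fun_prop) (by fun_prop)
  refine closure_minimal (fun p hp => ?_) hclosed h
  obtain ⟨h1, h2⟩ := hp
  -- The origin lies on the cut.
  have hk : p.1 ≠ 0 := fun h0 => h1 ⟨0, ⟨by simp, by simp⟩, by simp [h0]⟩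
  simp only [mem_ofPred_eq]
  have h3 : (((1 : ℂ) + edge ω c / p.1 ^ 2) ^ (1 / 2 : ℂ)) ^ 2 = 1 + edge ω c / p.1 ^ 2 := by
    rw [← Complex.cpow_nat_mul]
    norm_num
  rw [h2, zBranch, mul_pow, h3]
  field_simp

end CamassaHolm

end

theorem mainTheorem8 (ω c : ℝ) (hcω : 0 < c / ω) (l : ℕ) (u : ℝ → ℝ → ℝ)
    (hsol : CamassaHolm.IsClassicalSolution ω u)
    (hstep : CamassaHolm.IsStepLike c l u)
    (hpos : ∀ x t, 0 ≤ t → 0 < (CamassaHolm.momentum u x t + ω) / ω) :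
    (∀ k : ℂ, 0 ≤ k.im → CamassaHolm.lam k ≠ 0 →
      ∀ φ : ℝ → ℝ → ℂ, CamassaHolm.IsJostPlus ω u k φ →
        CamassaHolm.SolvesTEquation ω u (CamassaHolm.lam k) φ) ∧
    (∀ k z : ℂ, CamassaHolm.IsZValue ω c k z → 0 ≤ z.im → CamassaHolm.lam k ≠ 0 →
      ∀ φ : ℝ → ℝ → ℂ, CamassaHolm.IsJostMinus ω c u k z φ →
        CamassaHolm.SolvesTEquation ω u (CamassaHolm.lam k) φ) := by
  have hω : ω ≠ 0 := by rintro rfl; simp at hcω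
  have hω' : (ω : ℂ) ≠ 0 := by exact_mod_cast hω
  have hratio := CamassaHolm.step_ratio_pos hcω
  have hm : ∀ x t, 0 < t → CamassaHolm.momentum u x t + ω ≠ 0 := fun x t ht h0 => by
    have := hpos x t ht.le
    simp [h0] at this
  refine ⟨fun k hk hlm φ hφ => ?_, fun k z hz hz0 hlm φ hφ => ?_⟩
  -- At `+∞` the wave number is `k`, and `Im k ≥ 0` gives `|exp (-ikx)| ≥ 1` for `x ≥ 0`.
  · refine CamassaHolm.solvesTEquation_of_jost (κ := k) (A := 1) (d := 0) hω hsol hm hlm one_ne_zero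
      ?_ unitStable_atTop ?_ (fun a b ha hab => (hstep.asymptoticTo hsol ha hab).1)
      (fun t ht => (hφ t ht.le).1) fun t ht => ?_
    · simp only [CamassaHolm.lam]; push_cast; field_simp; ring
    · filter_upwards [eventually_ge_atTop 0] with x hx
      rw [Complex.norm_exp]
      refine Real.one_le_exp ?_
      simpa using mul_nonneg hk hx
    · have := (hφ t ht.le).2.const_mul
        (Complex.exp (-Complex.I * k * ((0 : ℝ) + ω / (2 * CamassaHolm.lam k)) * t))
      rw [mul_one] at this
      rw [one_mul]
      refine this.congr fun x => ?_
      rw [← mul_assoc, ← Complex.exp_add]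
      congr 2
      push_cast
      ring
  · set ρ : ℝ := √((c + ω) / ω) with hρ
    have hρ2 : (ρ : ℂ) ^ 2 = ((c : ℂ) + ω) / ω := by
      rw [← Complex.ofReal_pow, hρ, Real.sq_sqrt hratio.le]; push_cast; rfl
    set N : ℝ := ((c + ω) / ω) ^ (1 / 4 : ℝ) with hN
    have hN0 : (N : ℂ) ≠ 0 := by exact_mod_cast (Real.rpow_pos_of_pos hratio _).ne'
    have hcω' : (c : ℂ) + ω ≠ 0 := by
      have : c + ω ≠ 0 := fun h0 => by simp [h0] at hratio
      exact_mod_cast this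
    -- The left Jost solution behaves like `N⁻¹ exp (-izρ(x - (c + ω / (2λ))t))`, hence the sign of
    -- `κ`; `Im z ≥ 0` makes the rescaling factor at least one in modulus for `x ≤ 0`.
    refine CamassaHolm.solvesTEquation_of_jost (κ := -(z * ρ)) (A := (N : ℂ)⁻¹) (d := c) hω hsol hm
      hlm (inv_ne_zero hN0) ?_ unitStable_atBot ?_
      (fun a b ha hab => (hstep.asymptoticTo hsol ha hab).2)
      (fun t ht => (hφ t ht.le).1) fun t ht => ?_
    · rw [neg_sq, mul_pow, hρ2, hz.sq_eq, CamassaHolm.edge, CamassaHolm.lam]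
      push_cast
      field_simp
      ring
    · filter_upwards [eventually_le_atBot 0] with x hx
      rw [Complex.norm_exp]
      refine Real.one_le_exp ?_
      have h1 : (-Complex.I * -(z * ρ) * x).re = z.im * ρ * -x := by
        simp
      rw [h1]
      exact mul_nonneg (mul_nonneg hz0 (Real.sqrt_nonneg _)) (by linarith)
    · have := (hφ t ht.le).2.const_mul ((N : ℂ)⁻¹ *
        Complex.exp (-Complex.I * -(z * ρ) * (c + ω / (2 * CamassaHolm.lam k)) * t))
      rw [mul_one] at this
      refine this.congr fun x => ?_
      have e : Complex.exp (-Complex.I * -(z * ρ) * x)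
          = Complex.exp (-Complex.I * -(z * ρ) * (c + ω / (2 * CamassaHolm.lam k)) * t)
            * Complex.exp (Complex.I * z * ρ * (x - (c + ω / (2 * CamassaHolm.lam k)) * t)) := by
        rw [← Complex.exp_add]; congr 1; ring
      rw [e, ← hρ, ← hN]
      set E₁ := Complex.exp (-Complex.I * _ * _ * _)
      set E₂ := Complex.exp (Complex.I * _ * _ * _)
      field_simp
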